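/- An instance of f-SAND consists of a finite undirected graph with nonnegative edge costs $w_e$, a root $r$, and a finite family of colors $C_i\subseteq V\setminus\{r\}$. A feasible solution is an integer capacity installation $x\ge 0$ on the edges such that, for every $i$, all nodes of $C_i$ can simultaneously send one unit of flow to $r$ within the capacities $x$ (flows of different colors may share capacity); its cost is $\sum_e w_e x_e$. A tree solution is a feasible solution whose support (the edges of positive capacity with their endpoints, and $r$) is a tree. **Lemma.** There is a family of f-SAND instances, with numbers of nodes tending to infinity, on which the minimum cost of a tree solution is $\Omega(\log N)$ times the minimum cost of a solution, where $N$ is the number of nodes of the graph. More precisely, call a $d$-regular graph $G$ on $n$ vertices an expander if at least $|S|$ edges leave every vertex set $S$ with $|S|\le n/2$. For such $G$ let $b=\lfloor\sqrt n\rfloor$ and let $I_G$ be the instance obtained by adding a root $r$ joined to every vertex of $G$, with cost $n/b$ for the edges at $r$ and cost $1$ for the edges of $G$, the colors being all $b$-element subsets of $V(G)$. 1. There is a constant $d\ge 3$ such that $d$-regular expanders in this sense exist with arbitrarily large $n$. 2. For every $d\ge 3$ there are constants $K,c,\gamma>0$, depending only on $d$, such that for every $n\ge 1$ and every $d$-regular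 expander $G$ on $n$ vertices, $I_G$ has an optimal solution and an optimal tree solution, with costs $\mathrm{OPT}$ and $\mathrm{OPT}_{\mathrm{tree}}$ that satisfy $$0<\mathrm{OPT}\le Kn,\qquad \mathrm{OPT}_{\mathrm{tree}}\ge c\,n\log n,\qquad \mathrm{OPT}_{\mathrm{tree}}\ge \gamma\,\log(n+1)\cdot \mathrm{OPT}.$$ 3. Consequently, algorithms that always output a tree have approximation ratio $\Omega(\log N)$: there is $\gamma>0$ such that, whenever $\rho:\mathbb N\to\mathbb R$ is a function for which every feasible instance with $N$ nodes has a tree solution of cost at most $\rho(N)$ times the minimum cost of a solution, one has $\rho(N)\ge\gamma\log N$ for infinitely many $N$. -/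

import Mathlib

/-- An instance of the single-sink fractionally-subadditive network design problem (`f-SAND`) on a
finite vertex set `V`: an undirected graph with nonnegative edge costs, a root, and a finite family
of colors, which are sets of vertices that do not contain the root. -/
structure FSandInstance (V : Type*) [Fintype V] where
  graph : SimpleGraph V
  weight : Sym2 V → ℝ
  weight_nonneg : ∀ e ∈ graph.edgeSet, 0 ≤ weight e
  root : V
  colors : Finset (Finset V)
  root_notMem : ∀ C ∈ colors, root ∉ C

namespace FSandInstance

variable {V : Type*} [Fintype V]

open Classical in
/-- `f u v` is the amount of flow sent from `u` to `v`. Within the undirected capacities `x`, every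
node of `C` sends one unit to the root, simultaneously; flow is conserved at all other nodes. -/
structure IsFlow (I : FSandInstance V) (x : Sym2 V → ℕ) (C : Finset V) (f : V → V → ℝ) :
    Prop where
  nonneg : ∀ u v, 0 ≤ f u v
  capacity : ∀ u v, f u v + f v u ≤ (x s(u, v) : ℝ)
  conservation : ∀ v, v ≠ I.root → ∑ u, f v u - ∑ u, f u v = if v ∈ C then 1 else 0

/-- A feasible solution: an integer capacity installation on the edges of the graph which, for each
color separately, allows all nodes of the color to send one unit of flow to the root. -/
def IsFeasible (I : FSandInstance V) (x : Sym2 V → ℕ) : Prop :=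
  (∀ e, e ∉ I.graph.edgeSet → x e = 0) ∧ ∀ C ∈ I.colors, ∃ f : V → V → ℝ, I.IsFlow x C f

open Classical in
/-- The cost of a capacity installation. -/
noncomputable def cost (I : FSandInstance V) (x : Sym2 V → ℕ) : ℝ :=
  ∑ e ∈ I.graph.edgeFinset, I.weight e * (x e : ℝ)

/-- The graph on `V` formed by the edges with positive capacity. -/
def supportGraph (x : Sym2 V → ℕ) : SimpleGraph V :=
  SimpleGraph.fromEdgeSet {e | 0 < x e}

/-- A tree solution: a feasible solution whose support (the edges with positive capacity, their
endpoints, and the root) is a tree. -/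
def IsTreeSolution (I : FSandInstance V) (x : Sym2 V → ℕ) : Prop :=
  I.IsFeasible x ∧
    ((supportGraph x).induce (insert I.root (supportGraph x).support)).IsTree

/-- A feasible solution of minimum cost. -/
def IsOptimal (I : FSandInstance V) (x : Sym2 V → ℕ) : Prop :=
  I.IsFeasible x ∧ ∀ y, I.IsFeasible y → I.cost x ≤ I.cost y

/-- A tree solution of minimum cost among all tree solutions. -/
def IsOptimalTree (I : FSandInstance V) (x : Sym2 V → ℕ) : Prop :=
  I.IsTreeSolution x ∧ ∀ y, I.IsTreeSolution y → I.cost x ≤ I.cost y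

end FSandInstance

/-- Solutions that are trees achieve the approximation ratio `ρ`: every feasible instance with
`N` nodes has a tree solution whose cost is at most `ρ N` times the cost of any solution. This is
what an algorithm that always outputs a tree and has approximation ratio `ρ` provides. -/
def TreesAchieveRatio (ρ : ℕ → ℝ) : Prop :=
  ∀ (V : Type) [Fintype V] (I : FSandInstance V), (∃ x, I.IsFeasible x) →
    ∃ y, I.IsTreeSolution y ∧
      ∀ x, I.IsFeasible x → I.cost y ≤ ρ (Fintype.card V) * I.cost x

/-- The set of edges of `G` with exactly one endpoint in `S`. -/
def cutEdges {V : Type*} (G : SimpleGraph V) (S : Finset V) : Set (Sym2 V) :=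
  {e | ∃ u ∈ S, ∃ v, v ∉ S ∧ G.Adj u v ∧ e = s(u, v)}

open Classical in
/-- `G` is regular of degree `d` and has edge-expansion at least one: at least `|S|` edges leave
every set `S` that contains at most half of the vertices. -/
def IsUnitExpander {V : Type*} [Fintype V] (d : ℕ) (G : SimpleGraph V) : Prop :=
  G.IsRegularOfDegree d ∧
    ∀ S : Finset V, 2 * S.card ≤ Fintype.card V → S.card ≤ (cutEdges G S).ncard

/-- `G` together with a new vertex `none` that is joined to every vertex of `G`. -/
def coneGraph {V : Type*} (G : SimpleGraph V) : SimpleGraph (Option V) where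
  Adj
    | none, none => False
    | none, some _ => True
    | some _, none => True
    | some u, some v => G.Adj u v
  symm := ⟨by
    rintro (_ | u) (_ | v) h
    · exact h
    · trivial
    · trivial
    · exact G.adj_symm h⟩
  loopless := ⟨by
    rintro (_ | u) h
    · exact h
    · exact G.loopless.irrefl u h⟩

open Classical in
/-- The instance on `G` with an added root joined to all `n` vertices of `G`: the edges at the root
cost `n / b`, those of `G` cost `1`, and the colors are all sets of `b` vertices of `G`. -/
noncomputable def coneInstance {n : ℕ} (b : ℕ) (G : SimpleGraph (Fin n)) :
    FSandInstance (Option (Fin n)) where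
  graph := coneGraph G
  weight e := if none ∈ e then (n : ℝ) / (b : ℝ) else 1
  weight_nonneg e _ := by
    split_ifs
    · positivity
    · exact zero_le_one
  root := none
  colors := (Finset.univ.powersetCard b).map (Finset.mapEmbedding Function.Embedding.some).toEmbedding
  root_notMem C hC := by
    obtain ⟨S, -, rfl⟩ := Finset.mem_map.1 hC
    simp

/-! The cone over a bounded-degree expander separates trees from general solutions. Buying all edges
of `G` and `b` root edges, with end set `T`, at unit capacity costs O(n). This serves every color:
the demand that moves one unit from each node of a `b`-set `C` to the nodes of `T` satisfies every
cut condition of an expander, so max-flow min-cut routes it inside `G`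
(`exists_flow_of_cut_condition`, `cut_condition_of_isUnitExpander`). One fixed installation thus
works for all colors.

In a tree solution, the edge above `v` is the only exit from the subtree below `v`. Since every
`b`-set is a color, some color puts min(subtree size, `b`) terminals into that subtree, and the edge
needs that capacity. A vertex other than the root has at most `d` children, so for every `j ≤ b`,
apart from a contribution of the root's children, a fraction of order 1/(dj) of the vertices has at
least `j` descendants. Summing over `j` gives a harmonic sum
(`mul_harmonic_le_sum_min_card_descendants`). The correction is paid for by the root edges, which
cost n/b ≥ b each. With `b` about √n the harmonic sum is of order log n.

Expanders come from counting. A union bound gives four permutations of any finite set that expand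
all small sets by a factor 1/40 (`exists_expanding_perms`). To raise the expansion to one while
keeping the graph simple, many copies of the set are joined in a lift of a complete graph whose
triangles compose to these permutations (`completeLift_expansion`). Cuts grow with the number of
copies, while the loss in the argument does not. -/

/-! ### Expanding permutations by counting. -/

-- Chernoff-type bound: weight each subset `B` by `x ^ #B`; all weights together make `(1 + x) ^
-- #A`, and each small set has weight at least `x ^ (s / 40)`. The 40th power avoids fractional
-- exponents.
open Finset in
theorem card_small_subsets_pow_le {α : Type*} (A : Finset α) (s : ℕ) {x : ℝ}
    (hx : 0 < x) (hx1 : x ≤ 1) :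
    ((A.powerset.filter fun B => 40 * #B < s).card : ℝ) ^ 40 * x ^ s ≤ (1 + x) ^ (40 * #A) := by
  classical
  set F := A.powerset.filter fun B => 40 * #B < s with hF
  have h1 : (#F : ℝ) * x ^ ((s - 1) / 40) ≤ (1 + x) ^ #A := by
    calc (#F : ℝ) * x ^ ((s - 1) / 40) = ∑ B ∈ F, x ^ ((s - 1) / 40) := by simp
      _ ≤ ∑ B ∈ F, x ^ #B := by
          refine sum_le_sum fun B hB => pow_le_pow_of_le_one hx.le hx1 ?_
          have := (mem_filter.1 hB).2
          omega
      _ ≤ ∑ B ∈ A.powerset, x ^ #B :=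
          sum_le_sum_of_subset_of_nonneg (filter_subset _ _) fun _ _ _ => by positivity
      _ = (1 + x) ^ #A := by
          have := Finset.sum_pow_mul_eq_add_pow x 1 A
          simpa [add_comm] using this
  calc (#F : ℝ) ^ 40 * x ^ s ≤ (#F : ℝ) ^ 40 * x ^ (40 * ((s - 1) / 40)) := by
        refine mul_le_mul_of_nonneg_left (pow_le_pow_of_le_one hx.le hx1 ?_) (by positivity)
        omega
    _ = ((#F : ℝ) * x ^ ((s - 1) / 40)) ^ 40 := by rw [mul_pow, ← pow_mul, mul_comm 40]
    _ ≤ ((1 + x) ^ #A) ^ 40 := pow_le_pow_left₀ (by positivity) h1 _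
    _ = (1 + x) ^ (40 * #A) := by rw [← pow_mul, mul_comm]

/-- The binomial coefficient is the product of the ratios (n - i)/(s - i) for i < s, and none of
them is smaller than n/s. -/
theorem div_pow_le_choose {n s : ℕ} (hs : s ≤ n) : ((n : ℝ) / s) ^ s ≤ n.choose s := by
  induction s generalizing n with
  | zero => simp
  | succ k ih =>
    obtain ⟨m, rfl⟩ : ∃ m, n = m + 1 := ⟨n - 1, by omega⟩
    have hkm : k ≤ m := by omega
    have hc : ((m + 1).choose (k + 1) : ℝ) = ((m + 1 : ℕ) : ℝ) / (k + 1 : ℕ) * m.choose k := by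
      have := Nat.add_one_mul_choose_eq m k
      have h2 : ((m : ℝ) + 1) * m.choose k = (m + 1).choose (k + 1) * ((k : ℝ) + 1) := by
        exact_mod_cast this
      push_cast
      field_simp
      linarith
    rw [hc, pow_succ']
    refine mul_le_mul_of_nonneg_left (le_trans ?_ (ih hkm)) (by positivity)
    rcases Nat.eq_zero_or_pos k with rfl | hk
    · simp
    refine pow_le_pow_left₀ (by positivity) ?_ _
    have : (k : ℝ) ≤ m := by exact_mod_cast hkm
    rw [div_le_div_iff₀ (by positivity) (by positivity)]
    push_cast
    nlinarith

/-- The sets of the same size as `S` that are almost equal to `S`. -/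
def nearSets {α : Type*} [Fintype α] [DecidableEq α] (S : Finset α) : Finset (Finset α) :=
  (Finset.univ.powersetCard S.card).filter fun U => 40 * (U \ S).card < S.card

-- A near set `U` is determined by the pair `S \ U`, `U \ S` of small sets of equal size. Both are
-- counted by generating functions, and the threshold 1/40 is small enough for the product to be at
-- most the square root of the number of all sets of this size.
open Finset in
theorem card_nearSets_sq_le {α : Type*} [Fintype α] [DecidableEq α] (S : Finset α)
    (hS : S.Nonempty) (h2 : 2 * #S ≤ Fintype.card α) :
    (#(nearSets S)) ^ 2 ≤ (Fintype.card α).choose #S := by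
  set n := Fintype.card α with hn
  set s := #S with hs
  have hs0 : 0 < s := hS.card_pos
  set a := #(S.powerset.filter fun B => 40 * #B < s)
  set b := #(Sᶜ.powerset.filter fun B => 40 * #B < s)
  have hab : #(nearSets S) ≤ a * b := by
    rw [← card_product]
    refine card_le_card_of_injOn (fun U => (S \ U, U \ S)) ?_ ?_
    · intro U hU
      simp only [nearSets, coe_filter, mem_powersetCard, Set.mem_ofPred_eq] at hU
      have : #(S \ U) = #(U \ S) := card_sdiff_comm hU.1.2.symm
      simp only [coe_product, Set.mem_prod, mem_coe, mem_filter, mem_powerset]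
      refine ⟨⟨sdiff_subset, by rw [this]; exact hU.2⟩, ?_, hU.2⟩
      intro v hv
      simpa using (mem_sdiff.1 hv).2
    · intro U _ W _ h
      simp only [Prod.mk.injEq] at h
      ext v
      have h1 := Finset.ext_iff.1 h.1 v
      have h2 := Finset.ext_iff.1 h.2 v
      simp only [mem_sdiff] at h1 h2
      tauto
  have hsR : (0 : ℝ) < s := by exact_mod_cast hs0
  have hnR : (2 : ℝ) * s ≤ n := by exact_mod_cast h2
  have hn0 : (0 : ℝ) < n := by linarith
  set ν : ℝ := n / s with hν
  have hν2 : 2 ≤ ν := by rw [hν, le_div_iff₀ hsR]; exact hnR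
  have hνpos : 0 < ν := by linarith
  have hexp : ∀ x : ℝ, 0 ≤ x → ∀ k : ℕ, (1 + x) ^ k ≤ Real.exp (k * x) := by
    intro x hx k
    rw [Real.exp_nat_mul]
    exact pow_le_pow_left₀ (by linarith) (by linarith [Real.add_one_le_exp x]) _
  have ha : (a : ℝ) ^ 40 ≤ (Real.exp (5 / 2) * 16) ^ s := by
    have h := card_small_subsets_pow_le S s (x := 1 / 16) (by norm_num) (by norm_num)
    have h3 := h.trans (hexp (1 / 16) (by norm_num) _)
    have h4 : Real.exp (((40 * #S : ℕ) : ℝ) * (1 / 16)) = Real.exp (5 / 2) ^ s := by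
      rw [← Real.exp_nat_mul]; congr 1; push_cast; ring
    rw [h4, one_div, inv_pow, ← div_eq_mul_inv, div_le_iff₀ (by positivity)] at h3
    rwa [mul_pow]
  -- The weight 1/(16ν) = s/(16n) compensates for the larger ground set `Sᶜ`, so the exponential
  -- factor is the same as for `a`.
  have hb : (b : ℝ) ^ 40 ≤ (Real.exp (5 / 2) * (16 * ν)) ^ s := by
    have hx : (0 : ℝ) < 1 / (16 * ν) := by positivity
    have h := card_small_subsets_pow_le Sᶜ s (x := 1 / (16 * ν)) hx (by
      rw [div_le_one (by positivity)]; linarith)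
    have h3 := h.trans (hexp _ hx.le _)
    have h4 : Real.exp (((40 * #Sᶜ : ℕ) : ℝ) * (1 / (16 * ν))) ≤ Real.exp (5 / 2) ^ s := by
      rw [← Real.exp_nat_mul]
      refine Real.exp_le_exp.2 ?_
      have : (#Sᶜ : ℝ) ≤ n := by exact_mod_cast card_le_univ _
      have h5 : (n : ℝ) = ν * s := by rw [hν]; field_simp
      rw [mul_one_div, div_le_iff₀ (by positivity)]
      push_cast
      nlinarith
    have h6 := h3.trans h4
    rw [one_div, inv_pow, ← div_eq_mul_inv, div_le_iff₀ (by positivity)] at h6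
    rwa [mul_pow]
  have he : Real.exp 10 ≤ 2 ^ 20 := by
    have h1 := Real.exp_one_lt_d9
    have : Real.exp 10 = Real.exp 1 ^ 10 := by rw [← Real.exp_nat_mul]; norm_num
    rw [this]
    calc Real.exp 1 ^ 10 ≤ (2 ^ 2) ^ 10 := pow_le_pow_left₀ (by positivity) (by linarith) _
      _ = 2 ^ 20 := by norm_num
  have hfin : ((#(nearSets S) : ℝ) ^ 2) ^ 40 ≤ ((n.choose s : ℝ)) ^ 40 := by
    have hab' : (#(nearSets S) : ℝ) ≤ a * b := by exact_mod_cast hab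
    calc ((#(nearSets S) : ℝ) ^ 2) ^ 40 ≤ (((a : ℝ) * b) ^ 2) ^ 40 := by gcongr
      _ = ((a : ℝ) ^ 40 * (b : ℝ) ^ 40) ^ 2 := by ring
      _ ≤ ((Real.exp (5 / 2) * 16) ^ s * (Real.exp (5 / 2) * (16 * ν)) ^ s) ^ 2 := by gcongr
      _ = (Real.exp (5 / 2) ^ 4 * (2 ^ 16 * ν ^ 2)) ^ s := by
          rw [← mul_pow, ← pow_mul, mul_comm s 2, pow_mul]
          congr 1
          ring
      _ = (Real.exp 10 * (2 ^ 16 * ν ^ 2)) ^ s := by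
          rw [← Real.exp_nat_mul]; norm_num
      _ ≤ (ν ^ 40) ^ s := by
          refine pow_le_pow_left₀ (by positivity) ?_ _
          calc Real.exp 10 * (2 ^ 16 * ν ^ 2) ≤ 2 ^ 20 * (2 ^ 16 * ν ^ 2) := by gcongr
            _ = 2 ^ 36 * ν ^ 2 := by ring
            _ ≤ 2 ^ 38 * ν ^ 2 := by gcongr <;> norm_num
            _ ≤ ν ^ 38 * ν ^ 2 := by gcongr
            _ = ν ^ 40 := by ring
      _ = (ν ^ s) ^ 40 := by rw [← pow_mul, ← pow_mul, mul_comm]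
      _ ≤ _ := by
          refine pow_le_pow_left₀ (by positivity) (div_pow_le_choose ?_) _
          omega
  have := (pow_le_pow_iff_left₀ (by positivity) (by positivity) (by norm_num)).1 hfin
  exact_mod_cast this

open Finset in
/-- For a fixed set `S`, the images of `S` under the permutations are equidistributed among the
sets of the size of `S`. -/
theorem card_perm_image_mem_mul_choose {α : Type*} [Fintype α] [DecidableEq α] (S : Finset α)
    (𝓤 : Finset (Finset α)) (h𝓤 : 𝓤 ⊆ univ.powersetCard #S) :
    #(univ.filter fun π : Equiv.Perm α => S.map π.toEmbedding ∈ 𝓤) * (Fintype.card α).choose #S =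
      #𝓤 * Fintype.card (Equiv.Perm α) := by
  set κ := #(univ.filter fun π : Equiv.Perm α => S.map π.toEmbedding = S)
  have hfib : ∀ U ∈ univ.powersetCard #S,
      #(univ.filter fun π : Equiv.Perm α => S.map π.toEmbedding = U) = κ := by
    intro U hU
    obtain ⟨σ, hσ⟩ : ∃ σ : Equiv.Perm α, S.map σ.toEmbedding = U := by
      obtain ⟨e⟩ : Nonempty ({x // x ∈ S} ≃ {x // x ∈ U}) :=
        Fintype.card_eq.1 (by simpa using (mem_powersetCard.1 hU).2.symm)
      refine ⟨e.extendSubtype, ?_⟩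
      refine eq_of_subset_of_card_le ?_ (by simp [(mem_powersetCard.1 hU).2])
      intro v hv
      obtain ⟨u, hu, rfl⟩ := mem_map.1 hv
      exact e.extendSubtype_mem u hu
    -- Left multiplication by `σ` carries the stabilizer of `S` onto the permutations that send `S`
    -- to `U`.
    refine card_bij' (fun π _ => σ⁻¹ * π) (fun π _ => σ * π) ?_ ?_ ?_ ?_
    · intro π hπ
      simp only [mem_filter, mem_univ, true_and] at hπ ⊢
      rw [← hσ] at hπ
      ext v
      have := Finset.ext_iff.1 hπ (σ v)
      simp only [mem_map_equiv, ← Equiv.Perm.inv_def] at this ⊢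
      simpa using this
    · intro π hπ
      simp only [mem_filter, mem_univ, true_and] at hπ ⊢
      rw [← hσ]
      ext v
      have := Finset.ext_iff.1 hπ (σ⁻¹ v)
      simp only [mem_map_equiv, ← Equiv.Perm.inv_def] at this ⊢
      simpa using this
    · intro π _; simp
    · intro π _; simp
  have hsum : ∀ 𝓦 : Finset (Finset α), 𝓦 ⊆ univ.powersetCard #S →
      #(univ.filter fun π : Equiv.Perm α => S.map π.toEmbedding ∈ 𝓦) = #𝓦 * κ := by
    intro 𝓦 h𝓦
    rw [card_eq_sum_card_fiberwise (f := fun π : Equiv.Perm α => S.map π.toEmbedding) (t := 𝓦)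
      (fun π hπ => by simpa using hπ), ← smul_eq_mul, ← sum_const]
    refine sum_congr rfl fun U hU => ?_
    rw [← hfib U (h𝓦 hU)]
    congr 1
    ext π
    simp only [mem_filter, mem_univ, true_and, and_iff_right_iff_imp]
    rintro rfl
    exact hU
  have hall := hsum _ subset_rfl
  rw [filter_true_of_mem (fun π _ => by simp), card_powersetCard, card_univ, card_univ] at hall
  rw [hsum _ h𝓤, hall]
  ring

open Finset in
/-- Four permutations of any finite set suffice to expand all sets that contain at most half of the
elements. -/
theorem exists_expanding_perms (α : Type*) [Fintype α] [DecidableEq α] :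
    ∃ π : Fin 4 → Equiv.Perm α, ∀ S : Finset α, 2 * #S ≤ Fintype.card α →
      ∃ i, #S ≤ 40 * #(S.map (π i).toEmbedding \ S) := by
  by_contra! hcon
  set n := Fintype.card α with hn
  set F : ℝ := (Fintype.card (Equiv.Perm α) : ℝ) with hF
  have hFpos : 0 < F := by rw [hF]; exact_mod_cast Fintype.card_pos
  let bad : Finset α → Finset (Fin 4 → Equiv.Perm α) := fun S =>
    Fintype.piFinset fun _ => univ.filter fun π => S.map π.toEmbedding ∈ nearSets S
  set I : Finset (Finset α) := univ.powerset.filter fun S => S.Nonempty ∧ 2 * #S ≤ n with hI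
  have hcover : (univ : Finset (Fin 4 → Equiv.Perm α)) ⊆ I.biUnion bad := by
    intro π _
    obtain ⟨S, hS, h⟩ := hcon π
    refine mem_biUnion.2 ⟨S, ?_, ?_⟩
    · simp only [hI, powerset_univ, mem_filter, mem_univ, true_and]
      refine ⟨?_, hS⟩
      have := h 0
      exact card_pos.1 (by omega)
    · simp only [bad, Fintype.mem_piFinset, mem_filter, mem_univ, true_and, nearSets,
        mem_powersetCard, subset_univ, card_map]
      exact h
  -- One permutation is bad for `S` with probability at most `choose ^ (-1/2)`. Four independent
  -- ones give `choose ^ (-2)`, which leaves a factor `1 / choose` after summing over all sets of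
  -- one size.
  have hbad : ∀ S ∈ I, (#(bad S) : ℝ) ≤ F ^ 4 / (n.choose #S : ℝ) ^ 2 := by
    intro S hS
    simp only [hI, powerset_univ, mem_filter, mem_univ, true_and] at hS
    have hC : (0 : ℝ) < n.choose #S := by
      exact_mod_cast Nat.choose_pos (by omega)
    have h1 := card_perm_image_mem_mul_choose S (nearSets S) (filter_subset _ _)
    have h2 := card_nearSets_sq_le S hS.1 hS.2
    simp only [bad, Fintype.card_piFinset_const]
    set q := #(univ.filter fun π : Equiv.Perm α => S.map π.toEmbedding ∈ nearSets S)
    have h1' : (q : ℝ) * n.choose #S = #(nearSets S) * F := by rw [hF]; exact_mod_cast h1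
    have h2' : (#(nearSets S) : ℝ) ^ 2 ≤ n.choose #S := by exact_mod_cast h2
    rw [le_div_iff₀ (by positivity)]
    have h3 : ((q : ℝ) * n.choose #S) ^ 4 ≤ (n.choose #S : ℝ) ^ 2 * F ^ 4 := by
      rw [h1', mul_pow]
      have : (#(nearSets S) : ℝ) ^ 4 = (#(nearSets S) ^ 2) ^ 2 := by ring
      rw [this]
      gcongr
    have h4 : ((q : ℝ) ^ 4 * (n.choose #S) ^ 2) * (n.choose #S) ^ 2 ≤
        F ^ 4 * (n.choose #S : ℝ) ^ 2 := by nlinarith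
    push_cast
    exact le_of_mul_le_mul_right h4 (by positivity)
  have htot : F ^ 4 ≤ ∑ S ∈ I, F ^ 4 / (n.choose #S : ℝ) ^ 2 := by
    have h1 := (card_le_card hcover).trans card_biUnion_le
    rw [card_univ, Fintype.card_pi] at h1
    simp only [prod_const, card_univ, Fintype.card_fin] at h1
    calc F ^ 4 ≤ ∑ S ∈ I, (#(bad S) : ℝ) := by rw [hF]; exact_mod_cast h1
      _ ≤ _ := sum_le_sum hbad
  have hsum : ∑ S ∈ I, F ^ 4 / (n.choose #S : ℝ) ^ 2 =
      ∑ s ∈ Icc 1 (n / 2), F ^ 4 / (n.choose s : ℝ) := by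
    rw [hI, sum_filter]
    have := Finset.sum_powerset_apply_card (x := (univ : Finset α)) (fun s =>
      if 0 < s ∧ 2 * s ≤ n then F ^ 4 / (n.choose s : ℝ) ^ 2 else 0)
    simp only [← card_pos] at *
    rw [this, ← sum_subset (s₁ := Icc 1 (n / 2))]
    · refine sum_congr rfl fun s hs => ?_
      rw [mem_Icc] at hs
      rw [if_pos (by omega), card_univ, ← hn, nsmul_eq_mul]
      have hC : (0 : ℝ) < n.choose s := by
        exact_mod_cast Nat.choose_pos (by omega)
      field_simp
    · intro s hs
      simp only [mem_Icc, card_univ, ← hn, mem_range] at hs ⊢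
      omega
    · intro s _ hs
      rw [mem_Icc] at hs
      rw [if_neg (by omega), smul_zero]
  -- Up to the middle the binomial coefficients increase, so each is at least `n`; with at most `n /
  -- 2` sizes, the bad tuples make up at most half of all tuples.
  have hle : ∑ s ∈ Icc 1 (n / 2), F ^ 4 / (n.choose s : ℝ) ≤ (n / 2 : ℕ) * (F ^ 4 / n) := by
    refine (sum_le_card_nsmul _ _ (F ^ 4 / n) fun s hs => ?_).trans (by simp)
    rw [mem_Icc] at hs
    have hn0 : (0 : ℝ) < n := by exact_mod_cast (show 0 < n by omega)
    have : n ≤ n.choose s := by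
      have hmono : ∀ k, 1 ≤ k → k ≤ n / 2 → n ≤ n.choose k := by
        intro k hk
        induction k, hk using Nat.le_induction with
        | base => simp
        | succ k _ ih =>
          exact fun h => (ih (by omega)).trans (Nat.choose_le_succ_of_lt_half_left (by omega))
      exact hmono s hs.1 hs.2
    have : (n : ℝ) ≤ n.choose s := by exact_mod_cast this
    gcongr
  rw [hsum] at htot
  have hlt : ((n / 2 : ℕ) : ℝ) * (F ^ 4 / n) < F ^ 4 := by
    rcases Nat.eq_zero_or_pos n with h0 | h0
    · rw [h0]; simp; positivity
    have hn0 : (0 : ℝ) < n := by exact_mod_cast h0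
    have : ((n / 2 : ℕ) : ℝ) < n := by exact_mod_cast Nat.div_lt_self h0 (by norm_num)
    rw [mul_div_assoc', div_lt_iff₀ hn0, mul_comm]
    gcongr
  linarith

/-! ### Amplifying expansion by lifts of complete graphs. -/

theorem ncard_cutEdges_eq_sum {V : Type*} [Fintype V] [DecidableEq V] (G : SimpleGraph V)
    [DecidableRel G.Adj] (S : Finset V) :
    ((cutEdges G S).ncard : ℝ) = ∑ u, ∑ v, if G.Adj u v ∧ u ∈ S ∧ v ∉ S then (1 : ℝ) else 0 := by
  set F := (Finset.univ : Finset (V × V)).filter fun a => G.Adj a.1 a.2 ∧ a.1 ∈ S ∧ a.2 ∉ S with hF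
  have h1 : cutEdges G S = (fun a : V × V => s(a.1, a.2)) '' F := by
    ext e
    simp only [cutEdges, hF, Set.mem_ofPred_eq, Finset.coe_filter, Set.mem_image, Prod.exists,
      Finset.mem_univ, true_and]
    constructor
    · rintro ⟨u, hu, v, hv, ha, rfl⟩
      exact ⟨u, v, ⟨ha, hu, hv⟩, rfl⟩
    · rintro ⟨u, v, ⟨ha, hu, hv⟩, rfl⟩
      exact ⟨u, hu, v, hv, ha, rfl⟩
  have h2 : Set.InjOn (fun a : V × V => s(a.1, a.2)) F := by
    rintro ⟨a, b⟩ hab ⟨c, e⟩ hce h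
    simp only [hF, Finset.coe_filter, Finset.mem_univ, true_and, Set.mem_ofPred_eq] at hab hce
    rcases Sym2.eq_iff.1 h with ⟨rfl, rfl⟩ | ⟨rfl, rfl⟩
    · rfl
    · exact absurd hab.2.1 hce.2.2
  rw [h1, h2.ncard_image, Set.ncard_coe_finset, hF, ← Fintype.sum_prod_type'
    (f := fun u v => if G.Adj u v ∧ u ∈ S ∧ v ∉ S then (1 : ℝ) else 0), Finset.sum_boole]

theorem sum_adj_abs_indicator {V : Type*} [Fintype V] [DecidableEq V] (G : SimpleGraph V)
    [DecidableRel G.Adj] (S : Finset V) :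
    ∑ u, ∑ v, (if G.Adj u v then
      |(if u ∈ S then (1 : ℝ) else 0) - (if v ∈ S then 1 else 0)| else 0) =
      2 * (cutEdges G S).ncard := by
  have hsw : ((cutEdges G S).ncard : ℝ) =
      ∑ u, ∑ v, if G.Adj u v ∧ v ∈ S ∧ u ∉ S then (1 : ℝ) else 0 := by
    rw [ncard_cutEdges_eq_sum, Finset.sum_comm]
    simp only [G.adj_comm]
  rw [two_mul]
  nth_rw 1 [ncard_cutEdges_eq_sum]
  rw [hsw, ← Finset.sum_add_distrib]
  refine Finset.sum_congr rfl fun u _ => ?_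
  rw [← Finset.sum_add_distrib]
  refine Finset.sum_congr rfl fun v _ => ?_
  by_cases h1 : G.Adj u v <;> by_cases h2 : u ∈ S <;> by_cases h3 : v ∈ S <;> simp [h1, h2, h3]

theorem ncard_cutEdges_compl {V : Type*} [Fintype V] [DecidableEq V] (G : SimpleGraph V)
    (S : Finset V) : (cutEdges G Sᶜ).ncard = (cutEdges G S).ncard := by
  congr 1
  ext e
  simp only [cutEdges, Set.mem_ofPred_eq, Finset.mem_compl, not_not]
  constructor
  · rintro ⟨u, hu, v, hv, ha, rfl⟩
    exact ⟨v, hv, u, hu, ha.symm, Sym2.eq_swap⟩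
  · rintro ⟨u, hu, v, hv, ha, rfl⟩
    exact ⟨v, hv, u, hu, ha.symm, Sym2.eq_swap⟩

theorem IsUnitExpander.iso {V W : Type*} [Fintype V] [Fintype W] {d : ℕ} {G : SimpleGraph V}
    {H : SimpleGraph W} (e : G ≃g H) (hG : IsUnitExpander d G) : IsUnitExpander d H := by
  classical
  have hes : ∀ v, e.symm.toEquiv.symm v = e v := fun _ => rfl
  refine ⟨fun w => ?_, fun S hS => ?_⟩
  · rw [← hG.1 (e.symm w), ← SimpleGraph.card_neighborSet_eq_degree,
      ← SimpleGraph.card_neighborSet_eq_degree]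
    exact Fintype.card_congr (e.symm.mapNeighborSet w)
  · have h := hG.2 (S.map e.symm.toEquiv.toEmbedding) (by
      rw [Finset.card_map]; exact hS.trans_eq (Fintype.card_congr e.toEquiv).symm)
    rw [Finset.card_map] at h
    refine h.trans_eq ?_
    rw [← Set.ncard_image_of_injective (cutEdges G _) (Sym2.map.injective e.injective)]
    congr 1
    ext x
    simp only [cutEdges, Set.mem_image, Set.mem_ofPred_eq, Finset.mem_map_equiv, hes]
    constructor
    · rintro ⟨_, ⟨u, hu, v, hv, ha, rfl⟩, rfl⟩
      exact ⟨e u, hu, e v, hv, e.map_adj_iff.2 ha, rfl⟩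
    · rintro ⟨u, hu, v, hv, ha, rfl⟩
      refine ⟨s(e.symm u, e.symm v), ⟨e.symm u, ?_, e.symm v, ?_, e.symm.map_adj_iff.2 ha, rfl⟩, ?_⟩
      · simpa using hu
      · simpa using hv
      · simp

/-- The lift of the complete graph on `P` in which the fibres over `p` and `q` are matched by the
permutation `τ p q`. -/
def completeLift {P V : Type*} (τ : P → P → Equiv.Perm V) (hτ : ∀ p q, τ q p = (τ p q)⁻¹) :
    SimpleGraph (P × V) where
  Adj a b := a.1 ≠ b.1 ∧ b.2 = τ a.1 b.1 a.2
  symm := ⟨fun a b h => ⟨h.1.symm, by rw [hτ, h.2]; simp⟩⟩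
  loopless := ⟨fun _ h => h.1 rfl⟩

open Classical in
theorem completeLift_regular {P V : Type*} [Fintype P] [Fintype V] (τ : P → P → Equiv.Perm V)
    (hτ : ∀ p q, τ q p = (τ p q)⁻¹) :
    (completeLift τ hτ).IsRegularOfDegree (Fintype.card P - 1) := by
  rintro ⟨p, v⟩
  rw [← SimpleGraph.card_neighborFinset_eq_degree]
  have : (completeLift τ hτ).neighborFinset (p, v) =
      (Finset.univ.erase p).image fun q => (q, τ p q v) := by
    ext ⟨q, w⟩
    rw [SimpleGraph.mem_neighborFinset]
    simp only [completeLift, Finset.mem_image, Finset.mem_erase,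
      Finset.mem_univ, and_true, Prod.mk.injEq]
    constructor
    · rintro ⟨h1, h2⟩
      exact ⟨q, Ne.symm h1, rfl, h2.symm⟩
    · rintro ⟨q', h1, rfl, rfl⟩
      exact ⟨Ne.symm h1, rfl⟩
  rw [this, Finset.card_image_of_injective _ fun a b h => (Prod.mk.inj h).1,
    Finset.card_erase_of_mem (Finset.mem_univ _), Finset.card_univ]

/-- Every cut edge is seen from both ends, hence the factor 2. The condition `h1` makes the diagonal
terms vanish, so that sums may run over all pairs of layers. -/
theorem sum_completeLift_abs_indicator {P V : Type*} [Fintype P] [Fintype V] [DecidableEq P]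
    [DecidableEq V]
    (τ : P → P → Equiv.Perm V) (hτ : ∀ p q, τ q p = (τ p q)⁻¹) (h1 : ∀ p, τ p p = 1)
    (S : Finset (P × V)) :
    ∑ p, ∑ q, ∑ v, |(if (p, v) ∈ S then (1 : ℝ) else 0) - (if (q, τ p q v) ∈ S then 1 else 0)| =
      2 * (cutEdges (completeLift τ hτ) S).ncard := by
  classical
  rw [← sum_adj_abs_indicator, Fintype.sum_prod_type]
  refine Finset.sum_congr rfl fun p _ => ?_
  rw [Finset.sum_comm]
  refine Finset.sum_congr rfl fun v _ => ?_
  rw [Fintype.sum_prod_type]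
  refine Finset.sum_congr rfl fun q _ => ?_
  rw [Finset.sum_eq_single (τ p q v)]
  · by_cases hpq : p = q
    · subst hpq
      simp [completeLift, h1]
    · rw [if_pos (show (completeLift τ hτ).Adj _ _ from ⟨hpq, rfl⟩)]
  · intro w _ hw
    rw [if_neg]
    exact fun h => hw h.2
  · simp

/-- The permutations along which the layers are matched: the layers `inl x` are matched with
`inr (b, j)` by `π j`, and all other pairs by the identity. -/
def layerMatching {V A J : Type*} (π : J → Equiv.Perm V) :
    A ⊕ (A × J) → A ⊕ (A × J) → Equiv.Perm V
  | Sum.inl _, Sum.inl _ => 1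
  | Sum.inl _, Sum.inr y => π y.2
  | Sum.inr y, Sum.inl _ => (π y.2)⁻¹
  | Sum.inr _, Sum.inr _ => 1

theorem layerMatching_symm {V A J : Type*} (π : J → Equiv.Perm V) (p q : A ⊕ (A × J)) :
    layerMatching π q p = (layerMatching π p q)⁻¹ := by
  rcases p with p | p <;> rcases q with q | q <;> simp [layerMatching]

theorem layerMatching_self {V A J : Type*} (π : J → Equiv.Perm V) (p : A ⊕ (A × J)) :
    layerMatching π p p = 1 := by
  rcases p with p | p <;> simp [layerMatching]

-- The expansion in analytic form, to which the triangle inequality applies. Differences of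
-- indicators do not change in absolute value under complements, so a large `S` is handled through
-- `Sᶜ`.
open Finset in
theorem min_card_le_sum_abs {V J : Type*} [Fintype V] [Fintype J] [DecidableEq V]
    (π : J → Equiv.Perm V)
    (hπ : ∀ S : Finset V, 2 * #S ≤ Fintype.card V →
      ∃ i, #S ≤ 40 * #(S.map (π i).toEmbedding \ S)) (S : Finset V) :
    min (#S : ℝ) (Fintype.card V - #S) ≤
      40 * ∑ j, ∑ v, |(if v ∈ S then (1 : ℝ) else 0) - (if π j v ∈ S then 1 else 0)| := by
  have key : ∀ T : Finset V, 2 * #T ≤ Fintype.card V → (#T : ℝ) ≤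
      40 * ∑ j, ∑ v, |(if v ∈ T then (1 : ℝ) else 0) - (if π j v ∈ T then 1 else 0)| := by
    intro T hT
    obtain ⟨i, hi⟩ := hπ T hT
    have h1 : (#(T.map (π i).toEmbedding \ T) : ℝ) ≤
        ∑ v, |(if v ∈ T then (1 : ℝ) else 0) - (if π i v ∈ T then 1 else 0)| := by
      have : #(T.map (π i).toEmbedding \ T) = #(univ.filter fun v => v ∈ T ∧ π i v ∉ T) := by
        rw [← card_map (π i).toEmbedding (s := univ.filter fun v => v ∈ T ∧ π i v ∉ T)]
        congr 1
        ext v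
        simp [mem_map_equiv]
      rw [this, card_filter]
      push_cast
      refine sum_le_sum fun v _ => ?_
      by_cases h2 : v ∈ T <;> by_cases h3 : π i v ∈ T <;> simp [h2, h3]
    have h2 := single_le_sum (s := univ)
      (f := fun j => ∑ v, |(if v ∈ T then (1 : ℝ) else 0) - (if π j v ∈ T then 1 else 0)|)
      (fun j _ => by positivity) (mem_univ i)
    have h3 : (#T : ℝ) ≤ 40 * #(T.map (π i).toEmbedding \ T) := by exact_mod_cast hi
    linarith
  by_cases h : 2 * #S ≤ Fintype.card V
  · exact (min_le_left _ _).trans (key S h)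
  · have hc := card_compl S
    have hle := card_le_univ S
    have h2 := key Sᶜ (by omega)
    refine (min_le_right _ _).trans ?_
    rw [hc, Nat.cast_sub hle] at h2
    refine h2.trans_eq ?_
    congr 1
    refine sum_congr rfl fun j _ => sum_congr rfl fun v _ => ?_
    by_cases h2 : v ∈ S <;> by_cases h3 : π j v ∈ S <;> simp [h2, h3]

-- A set of small cut has nearly the same size in every layer, and within a layer `inl x` it is
-- nearly invariant under each `π j`, because `π j` is the composition around a triangle of layers.
-- Expansion then makes the layer nearly empty or nearly full; being at most half full on average,
-- the whole set is small. Averaging over the triangles yields the factor `Fintype.card A`.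
open Finset in
theorem completeLift_expansion {V A J : Type*} [Fintype V] [Fintype A] [Fintype J]
    [DecidableEq V] [DecidableEq A] [DecidableEq J]
    (π : J → Equiv.Perm V) (j₀ : J) (hj₀ : π j₀ = 1) (hA : 0 < Fintype.card A)
    (hπ : ∀ S : Finset V, 2 * #S ≤ Fintype.card V →
      ∃ i, #S ≤ 40 * #(S.map (π i).toEmbedding \ S))
    (S : Finset ((A ⊕ (A × J)) × V))
    (hS : 2 * #S ≤ Fintype.card ((A ⊕ (A × J)) × V)) :
    (Fintype.card A : ℝ) * #S ≤ (1 + 40 * (Fintype.card J + 2) * (Fintype.card J + 1)) *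
      (2 * (cutEdges (completeLift (layerMatching π) (layerMatching_symm π)) S).ncard) := by
  rw [← sum_completeLift_abs_indicator _ _ (layerMatching_self π)]
  set g : A ⊕ (A × J) → V → ℝ := fun p v => if (p, v) ∈ S then 1 else 0 with hg
  set D : A ⊕ (A × J) → A ⊕ (A × J) → ℝ := fun p q =>
    ∑ v, |g p v - g q (layerMatching π p q v)| with hD
  change _ ≤ _ * ∑ p, ∑ q, D p q
  set T := ∑ p, ∑ q, D p q with hT
  set M := (Fintype.card A : ℝ) with hM
  set K := (Fintype.card J : ℝ) with hK
  set n := (Fintype.card V : ℝ) with hn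
  set s : A ⊕ (A × J) → ℝ := fun p => ∑ v, g p v with hs
  have hM0 : 0 < M := by rw [hM]; exact_mod_cast hA
  have hK0 : 0 ≤ K := by positivity
  have hD0 : ∀ p q, 0 ≤ D p q := fun p q => sum_nonneg fun v _ => abs_nonneg _
  have hσ : (#S : ℝ) = ∑ p, s p := by
    rw [hs, ← Fintype.sum_prod_type' (f := g), hg]
    simp
  have hP : (Fintype.card (A ⊕ (A × J)) : ℝ) = M * (1 + K) := by
    simp [hM, hK]; ring
  have hhalf : 2 * (#S : ℝ) ≤ M * (1 + K) * n := by
    rw [← hP, hn]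
    rw [Fintype.card_prod] at hS
    exact_mod_cast hS
  have hsD : ∀ p q, |s p - s q| ≤ D p q := by
    intro p q
    have : s q = ∑ v, g q (layerMatching π p q v) :=
      (Equiv.sum_comp (layerMatching π p q) (g q)).symm
    rw [this, hs, ← sum_sub_distrib]
    exact abs_sum_le_sum_abs _ _
  have hTl : ∑ x, ∑ q, D (Sum.inl x) q ≤ T := by
    rw [hT, Fintype.sum_sum_type]
    exact le_add_of_nonneg_right (sum_nonneg fun _ _ => sum_nonneg fun _ _ => hD0 _ _)
  have hTr : ∑ y, ∑ q, D (Sum.inr y) q ≤ T := by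
    rw [hT, Fintype.sum_sum_type]
    exact le_add_of_nonneg_left (sum_nonneg fun _ _ => sum_nonneg fun _ _ => hD0 _ _)
  have hxy : ∑ x, ∑ b, ∑ j, D (Sum.inl x) (Sum.inr (b, j)) ≤ T := by
    refine le_trans (sum_le_sum fun x _ => ?_) hTl
    rw [Fintype.sum_sum_type, Fintype.sum_prod_type]
    exact le_add_of_nonneg_left (sum_nonneg fun _ _ => hD0 _ _)
  have hyy : ∑ b, ∑ j, ∑ c, D (Sum.inr (b, j)) (Sum.inr (c, j₀)) ≤ T := by
    rw [Fintype.sum_prod_type] at hTr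
    refine le_trans (sum_le_sum fun b _ => sum_le_sum fun j _ => ?_) hTr
    rw [Fintype.sum_sum_type, Fintype.sum_prod_type]
    refine le_trans (sum_le_sum fun c _ => ?_)
      (le_add_of_nonneg_left (sum_nonneg fun _ _ => hD0 _ _))
    exact single_le_sum (f := fun j' => D (Sum.inr (b, j)) (Sum.inr (c, j')))
      (fun _ _ => hD0 _ _) (mem_univ j₀)
  have hyx : ∑ c, ∑ x, D (Sum.inr (c, j₀)) (Sum.inl x) ≤ T := by
    rw [Fintype.sum_prod_type] at hTr
    refine le_trans (sum_le_sum fun c _ => ?_) hTr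
    refine le_trans ?_ (single_le_sum (f := fun j' => ∑ q, D (Sum.inr (c, j')) q)
      (fun _ _ => sum_nonneg fun _ _ => hD0 _ _) (mem_univ j₀))
    rw [Fintype.sum_sum_type]
    exact le_add_of_nonneg_right (sum_nonneg fun _ _ => hD0 _ _)
  -- Around the triangle `inl x`, `inr (b, j)`, `inr (c, j₀)` the matchings are `π j`, the identity,
  -- and the inverse of `π j₀ = 1`.
  have htri : ∀ x b c j, ∑ v, |g (Sum.inl x) v - g (Sum.inl x) (π j v)| ≤
      D (Sum.inl x) (Sum.inr (b, j)) + D (Sum.inr (b, j)) (Sum.inr (c, j₀)) +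
        D (Sum.inr (c, j₀)) (Sum.inl x) := by
    intro x b c j
    have h2 : D (Sum.inr (b, j)) (Sum.inr (c, j₀)) =
        ∑ v, |g (Sum.inr (b, j)) (π j v) - g (Sum.inr (c, j₀)) (π j v)| :=
      (Equiv.sum_comp (π j) fun v => |g (Sum.inr (b, j)) v - g (Sum.inr (c, j₀)) v|).symm
    have h3 : D (Sum.inr (c, j₀)) (Sum.inl x) =
        ∑ v, |g (Sum.inr (c, j₀)) (π j v) - g (Sum.inl x) (π j v)| := by
      rw [Equiv.sum_comp (π j) fun v => |g (Sum.inr (c, j₀)) v - g (Sum.inl x) v|]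
      simp [hD, layerMatching, hj₀]
    rw [h2, h3, hD, ← sum_add_distrib, ← sum_add_distrib]
    refine sum_le_sum fun v _ => ?_
    have e1 := abs_sub_le (g (Sum.inl x) v) (g (Sum.inr (b, j)) (π j v)) (g (Sum.inl x) (π j v))
    have e2 := abs_sub_le (g (Sum.inr (b, j)) (π j v)) (g (Sum.inr (c, j₀)) (π j v))
      (g (Sum.inl x) (π j v))
    simp only [layerMatching]
    linarith
  have hmin : ∀ x, min (s (Sum.inl x)) (n - s (Sum.inl x)) ≤
      40 * ∑ j, ∑ v, |g (Sum.inl x) v - g (Sum.inl x) (π j v)| := by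
    intro x
    have h := min_card_le_sum_abs π hπ (univ.filter fun v => (Sum.inl x, v) ∈ S)
    have h1 : s (Sum.inl x) = #(univ.filter fun v => ((Sum.inl x : A ⊕ (A × J)), v) ∈ S) := by
      simp [hs, hg]
    simp only [mem_filter, mem_univ, true_and] at h
    rw [h1]
    exact h
  -- Sum over all `b`, `c`, `j`. The first two sides of the triangle contribute `M * T` each; the
  -- third does not depend on `b` and `j` and contributes `M * K * T`.
  have hsum : M * ∑ x, min (s (Sum.inl x)) (n - s (Sum.inl x)) ≤ 40 * (K + 2) * T := by
    have h1 : M ^ 2 * ∑ x, min (s (Sum.inl x)) (n - s (Sum.inl x)) ≤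
        40 * ∑ x, ∑ b : A, ∑ c : A, ∑ j, (D (Sum.inl x) (Sum.inr (b, j)) +
          D (Sum.inr (b, j)) (Sum.inr (c, j₀)) + D (Sum.inr (c, j₀)) (Sum.inl x)) := by
      calc M ^ 2 * ∑ x, min (s (Sum.inl x)) (n - s (Sum.inl x))
          = ∑ x, ∑ b : A, ∑ c : A, min (s (Sum.inl x)) (n - s (Sum.inl x)) := by
            simp only [sum_const, card_univ, nsmul_eq_mul, ← mul_sum, hM]; ring
        _ ≤ ∑ x, ∑ b : A, ∑ c : A, 40 * ∑ j, (D (Sum.inl x) (Sum.inr (b, j)) +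
          D (Sum.inr (b, j)) (Sum.inr (c, j₀)) + D (Sum.inr (c, j₀)) (Sum.inl x)) := by
            refine sum_le_sum fun x _ => sum_le_sum fun b _ => sum_le_sum fun c _ => ?_
            refine (hmin x).trans (mul_le_mul_of_nonneg_left ?_ (by norm_num))
            exact sum_le_sum fun j _ => htri x b c j
        _ = _ := by simp only [mul_sum]
    have h2 : ∑ x, ∑ b : A, ∑ c : A, ∑ j, (D (Sum.inl x) (Sum.inr (b, j)) +
          D (Sum.inr (b, j)) (Sum.inr (c, j₀)) + D (Sum.inr (c, j₀)) (Sum.inl x)) =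
        M * ∑ x, ∑ b, ∑ j, D (Sum.inl x) (Sum.inr (b, j)) +
        M * ∑ b, ∑ j, ∑ c, D (Sum.inr (b, j)) (Sum.inr (c, j₀)) +
        M * (K * ∑ c, ∑ x, D (Sum.inr (c, j₀)) (Sum.inl x)) := by
      simp only [sum_add_distrib, sum_const, card_univ, nsmul_eq_mul, ← mul_sum, ← hM, ← hK]
      congr 1
      · congr 2
        refine sum_congr rfl fun b _ => ?_
        rw [sum_comm]
      · rw [sum_comm]
    rw [h2] at h1
    have h3 : M * (M * ∑ x, min (s (Sum.inl x)) (n - s (Sum.inl x))) ≤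
        M * (40 * (K + 2) * T) := by
      have e1 := mul_le_mul_of_nonneg_left hxy hM0.le
      have e2 := mul_le_mul_of_nonneg_left hyy hM0.le
      have e3 := mul_le_mul_of_nonneg_left (mul_le_mul_of_nonneg_left hyx hK0) hM0.le
      linarith
    exact le_of_mul_le_mul_left h3 hM0
  have hdev : ∑ x, |M * (1 + K) * s (Sum.inl x) - #S| ≤ T := by
    refine le_trans (sum_le_sum fun x _ => ?_) hTl
    have : M * (1 + K) * s (Sum.inl x) - #S = ∑ q, (s (Sum.inl x) - s q) := by
      rw [sum_sub_distrib, hσ, sum_const, card_univ, nsmul_eq_mul, hP]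
    rw [this]
    exact (abs_sum_le_sum_abs _ _).trans (sum_le_sum fun q _ => hsD _ _)
  -- Both entries of the minimum are bounded by means of the deviation from the average; the second
  -- also needs that `S` is at most half of all vertices.
  have hlow : ∀ x, (#S : ℝ) - |M * (1 + K) * s (Sum.inl x) - #S| ≤
      M * (1 + K) * min (s (Sum.inl x)) (n - s (Sum.inl x)) := by
    intro x
    have h1 := neg_abs_le (M * (1 + K) * s (Sum.inl x) - #S)
    have h2 := le_abs_self (M * (1 + K) * s (Sum.inl x) - #S)
    rw [mul_min_of_nonneg _ _ (by positivity)]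
    refine le_min ?_ ?_ <;> linarith
  have hfin := sum_le_sum fun x (_ : x ∈ (univ : Finset A)) => hlow x
  rw [sum_sub_distrib, sum_const, card_univ, nsmul_eq_mul, ← hM, ← mul_sum] at hfin
  have h5 := mul_le_mul_of_nonneg_left hsum (by linarith : 0 ≤ 1 + K)
  linarith

/-- Regular graphs of a fixed degree with edge expansion at least one exist with arbitrarily many
vertices. -/
theorem exists_unitExpanders :
    ∃ d : ℕ, 3 ≤ d ∧ ∀ n₀ : ℕ, ∃ n ≥ n₀, ∃ G : SimpleGraph (Fin n), IsUnitExpander d G := by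
  classical
  -- With five permutations (the identity and four expanding ones) the loss in
  -- `completeLift_expansion` is 2(1 + 40 · 7 · 6) = 3362, which this number of layers cancels
  -- exactly.
  refine ⟨Fintype.card (Fin 3362 ⊕ (Fin 3362 × Fin 5)) - 1, by simp, fun n₀ => ?_⟩
  obtain ⟨π, hπ⟩ := exists_expanding_perms (Fin n₀)
  let π' : Fin 5 → Equiv.Perm (Fin n₀) := Fin.cons 1 π
  have hπ' : ∀ S : Finset (Fin n₀), 2 * S.card ≤ Fintype.card (Fin n₀) →
      ∃ i, S.card ≤ 40 * (S.map (π' i).toEmbedding \ S).card := fun S hS => by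
    obtain ⟨i, hi⟩ := hπ S hS
    exact ⟨i.succ, by simpa [π'] using hi⟩
  let G := completeLift (layerMatching (A := Fin 3362) π') (layerMatching_symm π')
  have hG : IsUnitExpander (Fintype.card (Fin 3362 ⊕ (Fin 3362 × Fin 5)) - 1) G := by
    refine ⟨?_, fun S hS => ?_⟩
    · convert completeLift_regular (layerMatching (A := Fin 3362) π') (layerMatching_symm π')
    · have h := completeLift_expansion (A := Fin 3362) π' 0 (by simp [π']) (by simp) hπ' S hS
      simp only [Fintype.card_fin] at h
      norm_num at h
      exact_mod_cast (by linarith : (S.card : ℝ) ≤ ((cutEdges G S).ncard : ℝ))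
  have e := Fintype.equivFin ((Fin 3362 ⊕ (Fin 3362 × Fin 5)) × Fin n₀)
  refine ⟨_, ?_, _, hG.iso (SimpleGraph.Iso.map e G)⟩
  simp
  omega

/-! ### Max-flow min-cut by the coarea inequality and separation. -/

open MeasureTheory in
theorem integral_ite_lt {M p : ℝ} (h1 : -M ≤ p) (h2 : p ≤ M) :
    ∫ t in Set.Icc (-M) M, (if t < p then (1 : ℝ) else 0) = p + M := by
  have : (fun t : ℝ => if t < p then (1 : ℝ) else 0) = (Set.Iio p).indicator fun _ => 1 := by
    ext t; simp [Set.indicator]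
  rw [this, setIntegral_indicator measurableSet_Iio, setIntegral_const]
  have : Set.Icc (-M) M ∩ Set.Iio p = Set.Ico (-M) p := by
    ext t; simp only [Set.mem_inter_iff, Set.mem_Icc, Set.mem_Iio, Set.mem_Ico]
    constructor
    · rintro ⟨⟨h, _⟩, h'⟩; exact ⟨h, h'⟩
    · rintro ⟨h, h'⟩; exact ⟨⟨h, by linarith⟩, h'⟩
  rw [this, measureReal_def, Real.volume_Ico, ENNReal.toReal_ofReal (by linarith)]
  simp

open MeasureTheory in
theorem integrableOn_ite_lt (M p : ℝ) :
    IntegrableOn (fun t : ℝ => if t < p then (1 : ℝ) else 0) (Set.Icc (-M) M) := by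
  have : (fun t : ℝ => if t < p then (1 : ℝ) else 0) = (Set.Iio p).indicator fun _ => 1 := by
    ext t; simp [Set.indicator]
  rw [this]
  exact (integrableOn_const (by simp)).indicator measurableSet_Iio

open MeasureTheory in
/-- A discrete coarea inequality: cut conditions on the superlevel sets of a potential `p` bound its
total variation. -/
theorem sum_mul_le_sum_max_sub {V : Type*} [Fintype V] [DecidableEq V] (G : SimpleGraph V)
    [DecidableRel G.Adj] (b : V → ℝ) (hb : ∑ v, b v = 0)
    (hcut : ∀ S : Finset V, ∑ v ∈ S, b v ≤ (cutEdges G S).ncard) (p : V → ℝ) :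
    ∑ v, b v * p v ≤ ∑ u, ∑ v, if G.Adj u v then max (p u - p v) 0 else 0 := by
  obtain ⟨M, hM⟩ : ∃ M : ℝ, ∀ v, |p v| ≤ M :=
    ⟨∑ v, |p v|, fun v => Finset.single_le_sum (f := fun v => |p v|) (fun _ _ => abs_nonneg _)
      (Finset.mem_univ v)⟩
  let χ : V → ℝ → ℝ := fun v t => if t < p v then 1 else 0
  have hint : ∀ v, IntegrableOn (χ v) (Set.Icc (-M) M) := fun v => integrableOn_ite_lt M (p v)
  have hval : ∀ v, ∫ t in Set.Icc (-M) M, χ v t = p v + M := fun v =>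
    integral_ite_lt (abs_le.1 (hM v)).1 (abs_le.1 (hM v)).2
  have hpair : ∀ u v t, (if t < min (p u) (p v) then (1 : ℝ) else 0) = χ u t * χ v t := by
    intro u v t
    by_cases h1 : t < p u <;> by_cases h2 : t < p v <;> simp [χ, h1, h2]
  have hintm : ∀ u v, IntegrableOn (fun t => χ u t - χ u t * χ v t) (Set.Icc (-M) M) := by
    intro u v
    refine (hint u).sub ?_
    simp only [← hpair]
    exact integrableOn_ite_lt M _
  have hvalm : ∀ u v, ∫ t in Set.Icc (-M) M, (χ u t - χ u t * χ v t) = max (p u - p v) 0 := by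
    intro u v
    simp only [← hpair]
    rw [integral_sub (hint u) (integrableOn_ite_lt M _), hval, integral_ite_lt]
    · rcases le_total (p u) (p v) with h | h
      · rw [min_eq_left h, max_eq_right (by linarith)]; ring
      · rw [min_eq_right h, max_eq_left (by linarith)]; ring
    · exact le_min (abs_le.1 (hM u)).1 (abs_le.1 (hM v)).1
    · exact (min_le_left _ _).trans (abs_le.1 (hM u)).2
  -- At each threshold `t` this is the cut condition for the superlevel set of `p`; integrating over
  -- `t` gives the claim.
  have hpt : ∀ t, ∑ v, b v * χ v t ≤
      ∑ u, ∑ v, if G.Adj u v then χ u t - χ u t * χ v t else 0 := by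
    intro t
    have h := hcut (Finset.univ.filter fun v => t < p v)
    rw [ncard_cutEdges_eq_sum, Finset.sum_filter] at h
    refine le_trans (le_of_eq ?_) (h.trans (le_of_eq ?_))
    · refine Finset.sum_congr rfl fun v _ => ?_
      by_cases h1 : t < p v <;> simp [χ, h1]
    · refine Finset.sum_congr rfl fun u _ => Finset.sum_congr rfl fun v _ => ?_
      simp only [Finset.mem_filter, Finset.mem_univ, true_and]
      by_cases h0 : G.Adj u v <;> by_cases h1 : t < p u <;> by_cases h2 : t < p v <;>
        simp [χ, h0, h1, h2]
  have hi1 : ∀ u v, IntegrableOn (fun t => if G.Adj u v then χ u t - χ u t * χ v t else 0)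
      (Set.Icc (-M) M) := by
    intro u v
    by_cases h : G.Adj u v
    · simpa only [h, if_true] using hintm u v
    · simp [h]
  have hmono := setIntegral_mono (s := Set.Icc (-M) M) (μ := volume)
    (integrable_finsetSum _ fun v _ => (hint v).const_mul (b v))
    (integrable_finsetSum _ fun u _ => integrable_finsetSum _ fun v _ => hi1 u v) hpt
  rw [integral_finsetSum _ fun v _ => (hint v).const_mul (b v),
    integral_finsetSum _ fun u _ => integrable_finsetSum _ fun v _ => hi1 u v] at hmono
  -- The shift by `M` drops out because the demands sum to zero.
  have hl : ∑ v, ∫ t in Set.Icc (-M) M, b v * χ v t = ∑ v, b v * p v := by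
    simp only [integral_const_mul, hval, mul_add, Finset.sum_add_distrib, ← Finset.sum_mul, hb]
    ring
  rw [hl] at hmono
  refine hmono.trans_eq (Finset.sum_congr rfl fun u _ => ?_)
  rw [integral_finsetSum _ fun v _ => hi1 u v]
  refine Finset.sum_congr rfl fun v _ => ?_
  by_cases h : G.Adj u v
  · simp only [h, if_true, hvalm]
  · simp [h]

/-- The max-flow min-cut theorem for unit capacities and a balanced demand `b`. -/
theorem exists_flow_of_cut_condition {V : Type*} [Fintype V] [DecidableEq V] (G : SimpleGraph V)
    [DecidableRel G.Adj] (b : V → ℝ) (hb : ∑ v, b v = 0)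
    (hcut : ∀ S : Finset V, ∑ v ∈ S, b v ≤ (cutEdges G S).ncard) :
    ∃ f : V → V → ℝ, (∀ u v, 0 ≤ f u v) ∧
      (∀ u v, f u v + f v u ≤ if G.Adj u v then 1 else 0) ∧
      ∀ v, ∑ u, f v u - ∑ u, f u v = b v := by
  let F : Set (V → V → ℝ) := {f | (∀ u v, 0 ≤ f u v) ∧
    ∀ u v, f u v + f v u ≤ if G.Adj u v then 1 else 0}
  let div : (V → V → ℝ) →ₗ[ℝ] (V → ℝ) :=
    { toFun := fun f v => ∑ u, f v u - ∑ u, f u v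
      map_add' := fun f g => by
        ext v; simp only [Pi.add_apply, Finset.sum_add_distrib]; ring
      map_smul' := fun c f => by
        ext v
        simp only [Pi.smul_apply, smul_eq_mul, ← Finset.mul_sum, RingHom.id_apply]; ring }
  have hdivc : Continuous div := LinearMap.continuous_of_finiteDimensional div
  have hFconv : Convex ℝ F := by
    rintro f ⟨hf1, hf2⟩ g ⟨hg1, hg2⟩ a c ha hc hac
    refine ⟨fun u v => ?_, fun u v => ?_⟩
    · simp only [Pi.add_apply, Pi.smul_apply, smul_eq_mul]
      have := hf1 u v
      have := hg1 u v
      positivity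
    · simp only [Pi.add_apply, Pi.smul_apply, smul_eq_mul]
      have h1 := mul_le_mul_of_nonneg_left (hf2 u v) ha
      have h2 := mul_le_mul_of_nonneg_left (hg2 u v) hc
      calc _ = a * (f u v + f v u) + c * (g u v + g v u) := by ring
        _ ≤ _ := add_le_add h1 h2
        _ = _ := by rw [← add_mul, hac, one_mul]
  have hFclosed : IsClosed F := by
    have : F = (⋂ u, ⋂ v, {f | 0 ≤ f u v}) ∩
        ⋂ u, ⋂ v, {f | f u v + f v u ≤ if G.Adj u v then 1 else 0} := by
      ext f; simp [F]
    rw [this]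
    refine IsClosed.inter (isClosed_iInter fun u => isClosed_iInter fun v => ?_)
      (isClosed_iInter fun u => isClosed_iInter fun v => ?_)
    · exact isClosed_le continuous_const (by fun_prop)
    · exact isClosed_le (by fun_prop) continuous_const
  have hFcomp : IsCompact F := by
    refine IsCompact.of_isClosed_subset
      (isCompact_univ_pi fun _ : V => isCompact_univ_pi fun _ : V => isCompact_Icc (a := (0 : ℝ))
        (b := 1)) hFclosed ?_
    rintro f ⟨hf1, hf2⟩ u _ v _
    refine ⟨hf1 u v, ?_⟩
    have h1 := hf2 u v
    have h2 := hf1 v u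
    have h3 : (if G.Adj u v then (1 : ℝ) else 0) ≤ 1 := by split_ifs <;> norm_num
    linarith
  by_contra hno
  have hnot : b ∉ div '' F := by
    rintro ⟨f, hf, rfl⟩
    exact hno ⟨f, hf.1, hf.2, fun _ => rfl⟩
  -- If `b` is not the divergence of an admissible flow, a functional separates it from the compact
  -- convex set of such divergences. Its coordinates form a potential `p`.
  obtain ⟨ℓ, c, hlt, hgt⟩ := geometric_hahn_banach_closed_point
    (hFconv.linear_image div) (hFcomp.image hdivc).isClosed hnot
  let p : V → ℝ := fun v => ℓ (Pi.single v 1)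
  have hℓ : ∀ y : V → ℝ, ℓ y = ∑ v, y v * p v := by
    intro y
    conv_lhs => rw [← Finset.univ_sum_single y]
    rw [map_sum]
    refine Finset.sum_congr rfl fun v _ => ?_
    have : (Pi.single v (y v) : V → ℝ) = y v • Pi.single v 1 := by
      rw [← Pi.single_smul, smul_eq_mul, mul_one]
    rw [this, map_smul, smul_eq_mul]
  -- Saturating every edge downhill gives `ℓ (div f)` equal to the total variation of `p`, which by
  -- the coarea inequality is at least `ℓ b`.
  let f : V → V → ℝ := fun u v => if G.Adj u v ∧ p v < p u then 1 else 0
  have hf : f ∈ F := by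
    refine ⟨fun u v => by simp only [f]; split_ifs <;> norm_num, fun u v => ?_⟩
    simp only [f, G.adj_comm v u]
    by_cases h : G.Adj u v
    · rcases lt_trichotomy (p u) (p v) with h1 | h1 | h1
      · simp [h, h1, h1.not_gt]
      · simp [h, h1]
      · simp [h, h1, h1.not_gt]
    · simp [h]
  have h1 := hlt _ ⟨f, hf, rfl⟩
  have h2 : ℓ (div f) = ∑ u, ∑ v, if G.Adj u v then max (p u - p v) 0 else 0 := by
    rw [hℓ]
    have : ∀ v, div f v * p v = ∑ u, f v u * p v - ∑ u, f u v * p v := fun v => by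
      rw [← Finset.sum_mul, ← Finset.sum_mul, ← sub_mul]; rfl
    simp only [this, Finset.sum_sub_distrib]
    rw [Finset.sum_comm (f := fun v u => f u v * p v), ← Finset.sum_sub_distrib]
    refine Finset.sum_congr rfl fun u _ => ?_
    rw [← Finset.sum_sub_distrib]
    refine Finset.sum_congr rfl fun v _ => ?_
    by_cases h : G.Adj u v
    · rcases lt_or_ge (p v) (p u) with h1 | h1
      · simp [f, h, h1, h1.le]
      · simp [f, h, h1, h1.not_gt]
    · simp [f, h]
  have h3 := sum_mul_le_sum_max_sub G b hb hcut p
  rw [← h2, ← hℓ] at h3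
  linarith

/-! ### Solutions of the cone instance and the upper bound on the optimum. -/

namespace FSandInstance

open Classical in
/-- A minimum-cost capacity installation exists among those with any satisfiable property, since
the costs are integer multiples of `1 / b`. -/
theorem exists_min_cost_coneInstance {n b : ℕ} (hb : 0 < b) (G : SimpleGraph (Fin n))
    (Q : (Sym2 (Option (Fin n)) → ℕ) → Prop) (hQ : ∃ x, Q x) :
    ∃ x, Q x ∧ ∀ y, Q y → (coneInstance b G).cost x ≤ (coneInstance b G).cost y := by
  let c : (Sym2 (Option (Fin n)) → ℕ) → ℕ := fun x =>
    ∑ e ∈ (coneInstance b G).graph.edgeFinset, (if none ∈ e then n else b) * x e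
  have hb' : (0 : ℝ) < b := by exact_mod_cast hb
  have hc : ∀ x, (coneInstance b G).cost x = (c x : ℝ) / b := by
    intro x
    simp only [cost, c, Nat.cast_sum, Finset.sum_div]
    refine Finset.sum_congr rfl fun e _ => ?_
    by_cases h : none ∈ e <;> simp [coneInstance, h] <;> field_simp
  obtain ⟨x, hx, hmin⟩ : ∃ x, Q x ∧ ∀ y, Q y → c x ≤ c y := by
    have h : ∃ k x, Q x ∧ c x = k := by
      obtain ⟨x, hx⟩ := hQ
      exact ⟨_, x, hx, rfl⟩
    obtain ⟨x, hx, hk⟩ := Nat.find_spec h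
    exact ⟨x, hx, fun y hy => hk ▸ Nat.find_min' h ⟨y, hy, rfl⟩⟩
  refine ⟨x, hx, fun y hy => ?_⟩
  rw [hc, hc]
  have : (c x : ℝ) ≤ c y := by exact_mod_cast hmin y hy
  gcongr

theorem mem_colors_coneInstance {n b : ℕ} (G : SimpleGraph (Fin n)) (C : Finset (Option (Fin n))) :
    C ∈ (coneInstance b G).colors ↔
      ∃ S : Finset (Fin n), S.card = b ∧ S.map Function.Embedding.some = C := by
  simp [coneInstance, Finset.mem_map]

/-- The capacity installation with one unit of capacity on every edge at the root is a tree
solution. -/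
theorem exists_treeSolution_coneInstance {n b : ℕ} (G : SimpleGraph (Fin n)) :
    ∃ y, (coneInstance b G).IsTreeSolution y := by
  classical
  let y : Sym2 (Option (Fin n)) → ℕ := fun e => if ∃ v, e = s(none, some v) then 1 else 0
  have hy : ∀ v : Fin n, y s(none, some v) = 1 := fun v => if_pos ⟨v, rfl⟩
  have hy' : ∀ v : Fin n, y s(some v, none) = 1 := fun v => by rw [Sym2.eq_swap, hy]
  refine ⟨y, ⟨fun e he => if_neg ?_, fun C hC => ?_⟩, ?_⟩
  · rintro ⟨v, rfl⟩
    exact he (by simp [coneInstance, coneGraph])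
  · obtain ⟨S, -, rfl⟩ := (mem_colors_coneInstance G C).1 hC
    refine ⟨fun u v => match u, v with
      | some u, none => if u ∈ S then 1 else 0
      | _, _ => 0, ?_, ?_, ?_⟩
    · rintro (_ | u) (_ | v) <;> dsimp only <;> try split_ifs
      all_goals norm_num
    · rintro (_ | u) (_ | v) <;> dsimp only <;> try split_ifs
      all_goals simp [hy, hy']
    · rintro (_ | v) hv
      · exact absurd rfl hv
      · simp [Fintype.sum_option]
  · have hstar : supportGraph y = SimpleGraph.starGraph none := by
      ext u v
      rw [SimpleGraph.starGraph_adj, supportGraph, SimpleGraph.fromEdgeSet_adj]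
      rcases u with _ | u <;> rcases v with _ | v
      · simp
      · simp [hy]
      · simp [hy']
      · have : y s(some u, some v) = 0 := if_neg (by rintro ⟨w, hw⟩; simp at hw)
        simp [this]
    have huniv : insert (coneInstance b G).root (supportGraph y).support = Set.univ := by
      refine Set.eq_univ_of_forall fun v => ?_
      rcases v with _ | v
      · exact Or.inl rfl
      · refine Or.inr ⟨none, ?_⟩
        simp [hstar]
    rw [huniv, hstar]
    exact (SimpleGraph.induceUnivIso _).isTree_iff.2 (SimpleGraph.isTree_starGraph none)

/-- For small `S`, the cut already exceeds `#S`, which bounds `S ∩ C`. For large `S`, the surplus of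
`C` over `T` inside `S` is at most the part of `T` outside, hence at most `#Sᶜ`, and the expansion
of `Sᶜ` applies. -/
theorem cut_condition_of_isUnitExpander {n d : ℕ} {G : SimpleGraph (Fin n)} (hG : IsUnitExpander d G)
    {C T : Finset (Fin n)} (hCT : C.card = T.card) (S : Finset (Fin n)) :
    ∑ v ∈ S, ((if v ∈ C then (1 : ℝ) else 0) - if v ∈ T then 1 else 0) ≤ (cutEdges G S).ncard := by
  rw [Finset.sum_sub_distrib, Finset.sum_boole, Finset.sum_boole, Finset.filter_mem_eq_inter,
    Finset.filter_mem_eq_inter]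
  have h : (S ∩ C).card ≤ (cutEdges G S).ncard + (S ∩ T).card := by
    by_cases hS : 2 * S.card ≤ Fintype.card (Fin n)
    · have h1 := hG.2 S hS
      have h2 := Finset.card_le_card (Finset.inter_subset_left (s₁ := S) (s₂ := C))
      omega
    · have hc := Finset.card_compl S
      have hle := Finset.card_le_univ S
      have h1 := hG.2 Sᶜ (by omega)
      rw [ncard_cutEdges_compl] at h1
      have h2 : (T \ S).card ≤ Sᶜ.card :=
        Finset.card_le_card fun v hv => by simpa using (Finset.mem_sdiff.1 hv).2
      have h3 := Finset.card_sdiff_add_card_inter T S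
      have h4 := Finset.card_le_card (Finset.inter_subset_right (s₁ := S) (s₂ := C))
      rw [Finset.inter_comm T S] at h3
      omega
  have : ((S ∩ C).card : ℝ) ≤ (cutEdges G S).ncard + (S ∩ T).card := by exact_mod_cast h
  linarith

open Classical in
/-- On an expander, `b` edges at the root and all edges of `G`, with capacity one each, form a
feasible solution. -/
theorem exists_feasible_coneInstance_cost_le {n d b : ℕ} (hb : 0 < b) (hbn : b ≤ n)
    {G : SimpleGraph (Fin n)} (hG : IsUnitExpander d G) :
    ∃ x, (coneInstance b G).IsFeasible x ∧ (coneInstance b G).cost x ≤ (1 + d) * n := by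
  obtain ⟨T, -, hT⟩ := Finset.exists_subset_card_eq (s := (Finset.univ : Finset (Fin n))) (n := b)
    (by simpa using hbn)
  let A : Finset (Sym2 (Option (Fin n))) := T.image fun t => s(none, some t)
  let B : Finset (Sym2 (Option (Fin n))) := G.edgeFinset.image (Sym2.map some)
  have hA : ∀ v, s(none, some v) ∈ A ↔ v ∈ T := by intro v; simp [A]
  have hB : ∀ u v, s(some u, some v) ∈ B ↔ G.Adj u v := by
    intro u v
    simp only [B, Finset.mem_image, SimpleGraph.mem_edgeFinset]
    constructor
    · rintro ⟨e, he, h⟩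
      induction e with | _ a c =>
      rw [← Sym2.map_mk, (Sym2.map.injective (Option.some_injective _)).eq_iff] at h
      rw [h] at he
      exact he
    · intro h
      exact ⟨s(u, v), h, rfl⟩
  let x : Sym2 (Option (Fin n)) → ℕ := fun e => if e ∈ A ∪ B then 1 else 0
  refine ⟨x, ⟨fun e he => if_neg fun h => he ?_, fun C hC => ?_⟩, ?_⟩
  · rcases Finset.mem_union.1 h with h | h
    · obtain ⟨t, -, rfl⟩ := Finset.mem_image.1 h
      simp [coneInstance, coneGraph]
    · obtain ⟨e', he', rfl⟩ := Finset.mem_image.1 h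
      induction e' with | _ u v =>
      have hadj : G.Adj u v := SimpleGraph.mem_edgeFinset.1 he'
      exact hadj
  · obtain ⟨S, hS, rfl⟩ := (mem_colors_coneInstance G C).1 hC
    -- Inside `G` one unit is moved from each node of the color to each node of `T`; every node of
    -- `T` then forwards exactly one unit to the root.
    obtain ⟨g, hg0, hg1, hg2⟩ := exists_flow_of_cut_condition G
      (fun v => (if v ∈ S then (1 : ℝ) else 0) - if v ∈ T then 1 else 0)
      (by simp [Finset.sum_sub_distrib, hS, hT]) (cut_condition_of_isUnitExpander hG (hS.trans hT.symm))
    have hx1 : ∀ v, v ∈ T → x s(none, some v) = 1 := fun v hv =>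
      if_pos (Finset.mem_union_left _ ((hA v).2 hv))
    have hx2 : ∀ u v, G.Adj u v → x s(some u, some v) = 1 := fun u v h =>
      if_pos (Finset.mem_union_right _ ((hB u v).2 h))
    have hx1' : ∀ v, v ∈ T → x s(some v, none) = 1 := fun v hv => by rw [Sym2.eq_swap, hx1 v hv]
    refine ⟨fun u v => match u, v with
      | some u, none => if u ∈ T then 1 else 0
      | some u, some v => g u v
      | none, _ => 0, ?_, ?_, ?_⟩
    · rintro (_ | u) (_ | v) <;> dsimp only
      · exact le_rfl
      · exact le_rfl
      · split_ifs <;> norm_num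
      · exact hg0 u v
    · rintro (_ | u) (_ | v) <;> dsimp only
      · simp
      · split_ifs with h
        · simp [hx1 v h]
        · simp
      · split_ifs with h
        · simp [hx1' u h]
        · simp
      · refine (hg1 u v).trans ?_
        split_ifs with h
        · simp [hx2 u v h]
        · positivity
    · rintro (_ | v) hv
      · exact absurd rfl hv
      · have := hg2 v
        simp only [Fintype.sum_option, Finset.mem_map, Function.Embedding.some_apply,
          Option.some.injEq, exists_eq_right]
        linarith
  · have hb' : (0 : ℝ) < b := by exact_mod_cast hb
    have hpt : ∀ e, (coneInstance b G).weight e * (x e : ℝ) ≤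
        (if e ∈ A then (n : ℝ) / b else 0) + if e ∈ B then 1 else 0 := by
      intro e
      by_cases h1 : e ∈ A
      · have hn : none ∈ e := by
          obtain ⟨t, -, rfl⟩ := Finset.mem_image.1 h1
          simp
        have : (0 : ℝ) ≤ if e ∈ B then 1 else 0 := by split_ifs <;> norm_num
        simpa [x, h1, coneInstance, hn] using this
      · by_cases h2 : e ∈ B
        · have hn : none ∉ e := by
            obtain ⟨e, -, rfl⟩ := Finset.mem_image.1 h2
            simp [Sym2.mem_map]
          simp [x, h1, h2, coneInstance, hn]
        · simp [x, h1, h2]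
    have hcard : (B.card : ℝ) ≤ n * d := by
      have h1 : B.card ≤ G.edgeFinset.card := Finset.card_image_le
      have h2 := G.sum_degrees_eq_twice_card_edges
      have h3 : ∑ v, G.degree v = n * d := by
        rw [Finset.sum_congr rfl fun v _ => hG.1.degree_eq v]
        simp
      have h4 : B.card ≤ n * d := by omega
      exact_mod_cast h4
    have hcardA : (A.card : ℝ) ≤ b := by
      have : A.card ≤ b := Finset.card_image_le.trans hT.le
      exact_mod_cast this
    calc (coneInstance b G).cost x
        ≤ ∑ e ∈ (coneInstance b G).graph.edgeFinset,
          ((if e ∈ A then (n : ℝ) / b else 0) + if e ∈ B then 1 else 0) :=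
          Finset.sum_le_sum fun e _ => hpt e
      _ ≤ ∑ e, ((if e ∈ A then (n : ℝ) / b else 0) + if e ∈ B then 1 else 0) :=
          Finset.sum_le_sum_of_subset_of_nonneg (Finset.subset_univ _)
            fun e _ _ => by positivity
      _ = A.card * ((n : ℝ) / b) + B.card := by simp [Finset.sum_add_distrib, Finset.sum_ite_mem]
      _ ≤ b * ((n : ℝ) / b) + n * d := by gcongr
      _ = (1 + d) * n := by field_simp

theorem exists_color_mem {n b : ℕ} (hb : 0 < b) (hbn : b ≤ n) (G : SimpleGraph (Fin n))
    (v : Fin n) : ∃ C ∈ (coneInstance b G).colors, some v ∈ C := by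
  obtain ⟨S, hvS, -, hS⟩ := Finset.exists_subsuperset_card_eq (s := {v}) (t := Finset.univ)
    (Finset.subset_univ _) (n := b) (by simpa using Nat.succ_le_of_lt hb) (by simpa using hbn)
  exact ⟨_, (mem_colors_coneInstance G _).2 ⟨S, hS, rfl⟩, by simpa using hvS⟩

/-- In a feasible solution, every vertex is on an edge of positive capacity. -/
theorem IsFeasible.exists_pos {n b : ℕ} (hb : 0 < b) (hbn : b ≤ n) {G : SimpleGraph (Fin n)}
    {x : Sym2 (Option (Fin n)) → ℕ} (hx : (coneInstance b G).IsFeasible x) (v : Fin n) :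
    ∃ u, 0 < x s(some v, u) := by
  obtain ⟨C, hC, hv⟩ := exists_color_mem hb hbn G v
  obtain ⟨f, hf⟩ := hx.2 C hC
  by_contra! h
  have hcons := hf.conservation (some v) (by simp [coneInstance])
  have h0 : ∀ u, f (some v) u = 0 := by
    intro u
    have h1 := hf.capacity (some v) u
    have h2 := hf.nonneg (some v) u
    have h3 := hf.nonneg u (some v)
    rw [Nat.le_zero.1 (h u), Nat.cast_zero] at h1
    linarith
  have h4 : 0 ≤ ∑ u, f u (some v) := Finset.sum_nonneg fun u _ => hf.nonneg _ _
  rw [if_pos hv, Finset.sum_eq_zero fun u _ => h0 u] at hcons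
  linarith

theorem weight_coneInstance_pos {n b : ℕ} (hb : 0 < b) (hn : 0 < n) (G : SimpleGraph (Fin n))
    (e : Sym2 (Option (Fin n))) : 0 < (coneInstance b G).weight e := by
  simp only [coneInstance]
  split_ifs <;> positivity

theorem IsFeasible.cost_pos {n b : ℕ} (hb : 0 < b) (hbn : b ≤ n) {G : SimpleGraph (Fin n)}
    {x : Sym2 (Option (Fin n)) → ℕ} (hx : (coneInstance b G).IsFeasible x) :
    0 < (coneInstance b G).cost x := by
  classical
  obtain ⟨u, hu⟩ := hx.exists_pos hb hbn ⟨0, by omega⟩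
  have he : s(some (⟨0, by omega⟩ : Fin n), u) ∈ (coneInstance b G).graph.edgeSet := by
    by_contra h
    exact hu.ne' (hx.1 _ h)
  have hw := weight_coneInstance_pos hb (by omega : 0 < n) G
  refine Finset.sum_pos' (fun e _ => mul_nonneg (hw e).le (Nat.cast_nonneg _)) ⟨_, ?_,
    mul_pos (hw _) (Nat.cast_pos.2 hu)⟩
  simpa using he

end FSandInstance

/-! ### Subtree sizes in rooted trees. -/

/-- Every vertex of a rooted tree other than the root has a parent, and all edges join a vertex to
its parent. -/
theorem SimpleGraph.IsTree.exists_parent {V : Type*} {T : SimpleGraph V} (hT : T.IsTree) (r : V) :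
    ∃ (p : V → V) (depth : V → ℕ), (∀ v, v ≠ r → T.Adj v (p v) ∧ depth (p v) < depth v) ∧
      ∀ a b, T.Adj a b → (a ≠ r ∧ p a = b) ∨ (b ≠ r ∧ p b = a) := by
  choose P hP huniq using fun v => hT.existsUnique_path v r
  refine ⟨fun v => (P v).snd, fun v => (P v).length, fun v hv => ?_, fun a b hab => ?_⟩
  · have hnil : ¬ (P v).Nil := SimpleGraph.Walk.not_nil_of_ne hv
    refine ⟨(P v).adj_snd hnil, ?_⟩
    have h1 : (P v).tail = P (P v).snd := huniq _ _ (hP v).tail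
    have h2 := SimpleGraph.Walk.length_tail_add_one hnil
    rw [h1] at h2
    change (P (P v).snd).length < (P v).length
    omega
  · by_cases hb : b ∈ (P a).support
    · refine Or.inl ⟨?_, (hT.isAcyclic.eq_snd_of_adj_start (hP a) hab hb).symm⟩
      rintro rfl
      have : P a = SimpleGraph.Walk.nil := (huniq a _ SimpleGraph.Walk.IsPath.nil).symm
      rw [this, SimpleGraph.Walk.support_nil, List.mem_singleton] at hb
      exact hab.ne hb.symm
    · refine Or.inr ⟨fun h => hb (h ▸ (P a).end_mem_support), ?_⟩
      have : SimpleGraph.Walk.cons hab.symm (P a) = P b := huniq b _ ((hP a).cons hb)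
      change (P b).snd = a
      rw [← this, SimpleGraph.Walk.snd_cons]

open Classical in
/-- The descendants of `v`, including `v`, in the tree with root `r` and parent function `p`. -/
noncomputable def descendants {V : Type*} [Fintype V] (r : V) (p : V → V) (v : V) : Finset V :=
  Finset.univ.filter fun u => Relation.ReflTransGen (fun a b => a ≠ r ∧ b = p a) u v

section Descendants

variable {V : Type*} [Fintype V] {r : V} {p : V → V}

theorem mem_descendants {u v : V} :
    u ∈ descendants r p v ↔ Relation.ReflTransGen (fun a b => a ≠ r ∧ b = p a) u v := by
  simp [descendants]

theorem self_mem_descendants (v : V) : v ∈ descendants r p v :=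
  mem_descendants.2 Relation.ReflTransGen.refl

theorem mem_descendants_of_parent {u v : V} (hu : u ≠ r) (h : p u ∈ descendants r p v) :
    u ∈ descendants r p v :=
  mem_descendants.2 (Relation.ReflTransGen.head ⟨hu, rfl⟩ (mem_descendants.1 h))

theorem eq_or_parent_mem_descendants {u v : V} (h : u ∈ descendants r p v) :
    u = v ∨ (u ≠ r ∧ p u ∈ descendants r p v) := by
  rcases Relation.ReflTransGen.cases_head (mem_descendants.1 h) with h | ⟨c, ⟨h1, rfl⟩, h2⟩
  · exact Or.inl h
  · exact Or.inr ⟨h1, mem_descendants.2 h2⟩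

theorem root_notMem_descendants {v : V} (hv : v ≠ r) : r ∉ descendants r p v := fun h =>
  (eq_or_parent_mem_descendants h).elim (fun h => hv h.symm) fun h => h.1 rfl

/-- The only edge that leaves the descendants of `v` goes from `v` to its parent. -/
theorem eq_parent_of_adj_of_mem_descendants {T : SimpleGraph V}
    (hadj : ∀ a b, T.Adj a b → (a ≠ r ∧ p a = b) ∨ (b ≠ r ∧ p b = a)) {u v w : V}
    (huw : T.Adj u w) (hu : u ∈ descendants r p v) (hw : w ∉ descendants r p v) :
    u = v ∧ w = p v := by
  rcases hadj u w huw with ⟨-, rfl⟩ | ⟨h1, rfl⟩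
  · rcases eq_or_parent_mem_descendants hu with rfl | h
    · exact ⟨rfl, rfl⟩
    · exact absurd h.2 hw
  · exact absurd (mem_descendants_of_parent h1 hu) hw

open Finset in
/-- In a rooted tree in which every vertex other than the root has at most `d` children, many
vertices have at least `j` descendants. -/
theorem card_le_card_large_descendants [DecidableEq V] {depth : V → ℕ}
    (hdepth : ∀ v, v ≠ r → depth (p v) < depth v) {d : ℕ}
    (hd : ∀ v, v ≠ r → #{w | w ≠ r ∧ p w = v} ≤ d) (j : ℕ) :
    #(univ.erase r) ≤ #{v ∈ univ.erase r | j + 1 ≤ #(descendants r p v)} +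
      j * (#{w | w ≠ r ∧ p w = r} +
        d * #{v ∈ univ.erase r | j + 1 ≤ #(descendants r p v)}) := by
  set A := {v ∈ univ.erase r | j + 1 ≤ #(descendants r p v)} with hA
  -- A vertex outside `A` lies below a highest ancestor outside `A`, whose parent is the root or in
  -- `A`. Such ancestors are few, and each covers at most `j` vertices.
  let top : Finset V := univ.filter (fun w => w ≠ r ∧ p w = r) ∪
    A.biUnion fun v => univ.filter fun w => w ≠ r ∧ p w = v
  have htop : #top ≤ #{w | w ≠ r ∧ p w = r} + d * #A := by
    refine (card_union_le _ _).trans (Nat.add_le_add_left ?_ _)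
    rw [mul_comm]
    refine card_biUnion_le_card_mul _ _ _ fun v hv => hd v ?_
    exact (mem_erase.1 (mem_filter.1 hv).1).1
  have hmem : ∀ k u, depth u = k → u ≠ r → u ∉ A → ∃ w ∈ top, w ∉ A ∧ u ∈ descendants r p w := by
    intro k
    induction k using Nat.strong_induction_on with
    | _ k ih =>
      intro u hk hu huA
      by_cases h1 : p u = r
      · exact ⟨u, mem_union_left _ (by simp [hu, h1]), huA, self_mem_descendants u⟩
      by_cases h2 : p u ∈ A
      · exact ⟨u, mem_union_right _ (mem_biUnion.2 ⟨p u, h2, by simp [hu]⟩), huA,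
          self_mem_descendants u⟩
      · obtain ⟨w, hw, hwA, hm⟩ := ih _ (hk ▸ hdepth u hu) (p u) rfl h1 h2
        exact ⟨w, hw, hwA, mem_descendants_of_parent hu hm⟩
  have hsub : univ.erase r ⊆ A ∪ (top.filter fun w => w ∉ A).biUnion (descendants r p) := by
    intro u hu
    by_cases huA : u ∈ A
    · exact mem_union_left _ huA
    · obtain ⟨w, hw, hwA, hm⟩ := hmem _ u rfl (mem_erase.1 hu).1 huA
      exact mem_union_right _ (mem_biUnion.2 ⟨w, mem_filter.2 ⟨hw, hwA⟩, hm⟩)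
  refine (card_le_card hsub).trans ((card_union_le _ _).trans (Nat.add_le_add_left ?_ _))
  have hsmall : ∀ w ∈ top.filter fun w => w ∉ A, #(descendants r p w) ≤ j := by
    intro w hw
    obtain ⟨hw, hwA⟩ := mem_filter.1 hw
    have hwr : w ≠ r := by
      rcases mem_union.1 hw with h | h
      · exact (mem_filter.1 h).2.1
      · obtain ⟨v, -, h⟩ := mem_biUnion.1 h
        exact (mem_filter.1 h).2.1
    by_contra! h
    exact hwA (mem_filter.2 ⟨mem_erase.2 ⟨hwr, mem_univ _⟩, h⟩)
  refine (card_biUnion_le_card_mul _ _ _ hsmall).trans ?_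
  rw [mul_comm]
  exact Nat.mul_le_mul_left _ ((card_filter_le _ _).trans htop)

-- Layer-cake summation: min(m, b) counts the thresholds `j + 1 ≤ b` that `m` reaches. At each
-- threshold `card_le_card_large_descendants` is divided by `j + 1`, which produces the harmonic
-- sum.
open Finset in
theorem mul_harmonic_le_sum_min_card_descendants [DecidableEq V] {depth : V → ℕ}
    (hdepth : ∀ v, v ≠ r → depth (p v) < depth v) {d : ℕ} (hd0 : 1 ≤ d)
    (hd : ∀ v, v ≠ r → #{w | w ≠ r ∧ p w = v} ≤ d) (b : ℕ) :
    (#(univ.erase r) : ℝ) * harmonic b ≤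
      d * ∑ v ∈ univ.erase r, (min #(descendants r p v) b : ℕ) +
        b * #{w | w ≠ r ∧ p w = r} := by
  have hmin : ∀ m : ℕ, min m b = ∑ j ∈ range b, if j + 1 ≤ m then 1 else 0 := by
    intro m
    rw [sum_boole, Nat.cast_id]
    have : (range b).filter (fun j => j + 1 ≤ m) = range (min m b) := by
      ext j; simp only [mem_filter, mem_range]; omega
    rw [this, card_range]
  have hsum : ∑ v ∈ univ.erase r, min #(descendants r p v) b =
      ∑ j ∈ range b, #{v ∈ univ.erase r | j + 1 ≤ #(descendants r p v)} := by
    simp only [hmin, card_filter]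
    rw [sum_comm]
  rw [hsum]
  simp only [harmonic, Rat.cast_sum]
  push_cast
  have hconst : (b : ℝ) * #{w | w ≠ r ∧ p w = r} = ∑ _j ∈ range b, (#{w | w ≠ r ∧ p w = r} : ℝ) := by
    rw [sum_const, card_range, nsmul_eq_mul]
  rw [mul_sum, mul_sum, hconst, ← sum_add_distrib]
  refine sum_le_sum fun j _ => ?_
  have h := card_le_card_large_descendants hdepth hd j
  set a := #{v ∈ univ.erase r | j + 1 ≤ #(descendants r p v)}
  set k := #{w | w ≠ r ∧ p w = r}
  -- Here `1 ≤ d` absorbs the vertices counted by `a` itself.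
  have h2 : #(univ.erase r) ≤ (d * a + k) * (j + 1) := by nlinarith
  rw [← div_eq_mul_inv, div_le_iff₀ (by positivity)]
  exact_mod_cast h2

end Descendants

/-! ### The lower bound for tree solutions. -/

namespace FSandInstance

open Finset in
/-- The demand inside a set is at most the capacity that leaves the set. -/
theorem IsFlow.card_inter_le {V : Type*} [Fintype V] [DecidableEq V] {I : FSandInstance V}
    {x : Sym2 V → ℕ} {C : Finset V} {f : V → V → ℝ} (hf : I.IsFlow x C f) {D : Finset V}
    (hD : I.root ∉ D) : #(D ∩ C) ≤ ∑ u ∈ D, ∑ w ∈ Dᶜ, x s(u, w) := by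
  have h1 : ∑ v ∈ D, (∑ u, f v u - ∑ u, f u v) = #(D ∩ C) := by
    rw [sum_congr rfl fun v hv => hf.conservation v fun h => hD (h ▸ hv), ← filter_mem_eq_inter, card_filter]
    push_cast
    exact sum_congr rfl fun v _ => by congr
  have h2 : ∑ v ∈ D, (∑ u, f v u - ∑ u, f u v) ≤ ∑ u ∈ D, ∑ w ∈ Dᶜ, f u w := by
    have e1 : ∀ v, ∑ u, f v u = ∑ u ∈ D, f v u + ∑ u ∈ Dᶜ, f v u := fun v =>
      (sum_add_sum_compl D _).symm
    have e2 : ∀ v, ∑ u ∈ D, f u v ≤ ∑ u, f u v := fun v =>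
      sum_le_sum_of_subset_of_nonneg (subset_univ _) fun _ _ _ => hf.nonneg _ _
    calc ∑ v ∈ D, (∑ u, f v u - ∑ u, f u v)
        ≤ ∑ v ∈ D, (∑ u ∈ D, f v u + ∑ u ∈ Dᶜ, f v u - ∑ u ∈ D, f u v) :=
          sum_le_sum fun v _ => by rw [e1]; linarith [e2 v]
      _ = ∑ u ∈ D, ∑ w ∈ Dᶜ, f u w := by
          rw [sum_sub_distrib, sum_add_distrib, sum_comm (f := fun v u => f u v)]
          ring
  have h3 : ∑ u ∈ D, ∑ w ∈ Dᶜ, f u w ≤ ∑ u ∈ D, ∑ w ∈ Dᶜ, (x s(u, w) : ℝ) :=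
    sum_le_sum fun u _ => sum_le_sum fun w _ => by
      linarith [hf.capacity u w, hf.nonneg w u]
  have h4 : (#(D ∩ C) : ℝ) ≤ ∑ u ∈ D, ∑ w ∈ Dᶜ, (x s(u, w) : ℝ) := by
    rw [← h1]; exact h2.trans h3
  exact_mod_cast h4

-- All `b`-sets are colors, so one can be chosen inside `D` or around it. This is where the richness
-- of the family of colors enters.
open Finset in
theorem exists_color_min_le_card_inter {n b : ℕ} (hbn : b ≤ n) (G : SimpleGraph (Fin n))
    {D : Finset (Option (Fin n))} (hD : none ∉ D) :
    ∃ C ∈ (coneInstance b G).colors, min #D b ≤ #(D ∩ C) := by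
  classical
  obtain ⟨E, hE⟩ : ∃ E : Finset (Fin n), E.map Function.Embedding.some = D := by
    refine ⟨univ.filter fun v => some v ∈ D, ?_⟩
    ext v
    rcases v with _ | v <;> simp [hD]
  subst hE
  rw [card_map]
  rcases le_total #E b with h | h
  · obtain ⟨S, hES, -, hS⟩ := exists_subsuperset_card_eq (subset_univ E) h (by simpa using hbn)
    refine ⟨_, (mem_colors_coneInstance G _).2 ⟨S, hS, rfl⟩, ?_⟩
    rw [← map_inter, card_map, inter_eq_left.2 hES]
    exact min_le_left _ _
  · obtain ⟨S, hSE, hS⟩ := exists_subset_card_eq h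
    refine ⟨_, (mem_colors_coneInstance G _).2 ⟨S, hS, rfl⟩, ?_⟩
    rw [← map_inter, card_map, inter_eq_right.2 hSE, hS]
    exact min_le_right _ _

open Finset Classical in
/-- The lower bound for tree solutions: a tree solution pays for the harmonic growth of its
subtrees. -/
theorem IsTreeSolution.mul_harmonic_le_cost {n d b : ℕ} (hb : 0 < b) (hbn : b * b ≤ n)
    (hd : 1 ≤ d) {G : SimpleGraph (Fin n)} (hG : G.IsRegularOfDegree d)
    {x : Sym2 (Option (Fin n)) → ℕ} (hx : (coneInstance b G).IsTreeSolution x) :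
    (n : ℝ) * harmonic b ≤ (d + 1) * (coneInstance b G).cost x := by
  have hbn' : b ≤ n := le_trans (Nat.le_mul_self b) hbn
  obtain ⟨hfeas, htree⟩ := hx
  have huniv : insert (coneInstance b G).root (supportGraph x).support = Set.univ := by
    refine Set.eq_univ_of_forall fun v => ?_
    rcases v with _ | v
    · exact Or.inl rfl
    · obtain ⟨u, hu⟩ := hfeas.exists_pos hb hbn' v
      refine Or.inr ⟨u, ?_⟩
      change (supportGraph x).Adj (some v) u
      rw [supportGraph, SimpleGraph.fromEdgeSet_adj]
      refine ⟨hu, ?_⟩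
      rintro rfl
      exact hu.ne' (hfeas.1 _ fun h =>
        (coneInstance b G).graph.loopless.irrefl _ (SimpleGraph.mem_edgeSet _ |>.1 h))
  rw [huniv] at htree
  have hT : (supportGraph x).IsTree := (SimpleGraph.induceUnivIso _).isTree_iff.1 htree
  obtain ⟨p, depth, hp, hadj⟩ := hT.exists_parent none
  have hcone : ∀ u v, (supportGraph x).Adj u v → (coneGraph G).Adj u v := by
    intro u v h
    rw [supportGraph, SimpleGraph.fromEdgeSet_adj] at h
    by_contra hc
    have h1 : 0 < x s(u, v) := h.1
    exact h1.ne' (hfeas.1 _ hc)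
  have hchild : ∀ v, v ≠ none → #{w | w ≠ none ∧ p w = v} ≤ d := by
    intro v hv
    obtain ⟨v, rfl⟩ := Option.ne_none_iff_exists'.1 hv
    rw [← hG.degree_eq v, ← SimpleGraph.card_neighborFinset_eq_degree,
      ← card_map Function.Embedding.some (s := G.neighborFinset v)]
    refine card_le_card fun w hw => ?_
    simp only [mem_filter, mem_univ, true_and] at hw
    obtain ⟨w, rfl⟩ := Option.ne_none_iff_exists'.1 hw.1
    have h1 := hcone _ _ (hp (some w) hw.1).1
    rw [hw.2] at h1
    have h2 : G.Adj w v := h1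
    simpa using h2.symm
  have hmain := mul_harmonic_le_sum_min_card_descendants (r := none) (p := p) (depth := depth)
    (fun v hv => (hp v hv).2) hd hchild b
  -- A color concentrated in the subtree of `v` must leave it through the parent edge, the only edge
  -- of the support that does.
  have hcap : ∀ v, v ≠ none → min #(descendants none p v) b ≤ x s(v, p v) := by
    intro v hv
    have hroot : none ∉ descendants none p v := root_notMem_descendants hv
    obtain ⟨C, hC, hCc⟩ := exists_color_min_le_card_inter hbn' G hroot
    obtain ⟨f, hf⟩ := hfeas.2 C hC
    refine hCc.trans ((hf.card_inter_le hroot).trans ?_)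
    have hzero : ∀ u ∈ descendants none p v, ∀ w ∈ (descendants none p v)ᶜ,
        ¬ (u = v ∧ w = p v) → x s(u, w) = 0 := by
      intro u hu w hw hne
      by_contra hxne
      refine hne (eq_parent_of_adj_of_mem_descendants hadj (T := supportGraph x) ?_ hu
        (mem_compl.1 hw))
      rw [supportGraph, SimpleGraph.fromEdgeSet_adj]
      exact ⟨Nat.pos_of_ne_zero hxne, fun h => mem_compl.1 hw (h ▸ hu)⟩
    rw [sum_eq_single_of_mem v (self_mem_descendants v)
      fun u hu huv => sum_eq_zero fun w hw => hzero u hu w hw fun h => huv h.1]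
    by_cases hpv : p v ∈ (descendants none p v)ᶜ
    · rw [sum_eq_single_of_mem (p v) hpv
        fun w hw hwp => hzero v (self_mem_descendants v) w hw fun h => hwp h.2]
    · rw [sum_eq_zero fun w hw => hzero v (self_mem_descendants v) w hw fun h => hpv (h.2 ▸ hw)]
      exact Nat.zero_le _
  have hn0 : 0 < n := by omega
  have hbR : (0 : ℝ) < b := by exact_mod_cast hb
  have hw := weight_coneInstance_pos hb hn0 G
  -- Two vertices cannot be each other's parents, since depth decreases strictly; so the costs of
  -- the parent edges may be added.
  have hinj : Set.InjOn (fun v => s(v, p v)) (univ.erase (none : Option (Fin n)) : Finset _) := by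
    intro u hu v hv h
    simp only [coe_erase, coe_univ, Set.mem_sdiff, Set.mem_univ, Set.mem_singleton_iff,
      true_and] at hu hv
    rcases Sym2.eq_iff.1 h with h | h
    · exact h.1
    · have h1 := (hp u hu).2
      have h2 := (hp v hv).2
      rw [h.2] at h1
      rw [← h.1] at h2
      omega
  have hcost : ∑ v ∈ univ.erase none, (coneInstance b G).weight s(v, p v) * (x s(v, p v) : ℝ) ≤
      (coneInstance b G).cost x := by
    rw [cost, ← sum_image (f := fun e => (coneInstance b G).weight e * (x e : ℝ)) hinj]
    refine sum_le_sum_of_subset_of_nonneg (fun e he => ?_)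
      fun e _ _ => mul_nonneg (hw e).le (Nat.cast_nonneg _)
    obtain ⟨v, hv, rfl⟩ := mem_image.1 he
    exact SimpleGraph.mem_edgeFinset.2 (hcone _ _ (hp v (mem_erase.1 hv).1).1)
  -- This is where `b * b ≤ n` matters: each root edge in use costs at least `b`, so the cost also
  -- dominates the root term of the harmonic bound.
  have hnb : (b : ℝ) ≤ n / b := by
    rw [le_div_iff₀ hbR]; exact_mod_cast hbn
  have hb1 : (1 : ℝ) ≤ b := by exact_mod_cast hb
  have hsum1 : ((∑ v ∈ univ.erase none, min #(descendants none p v) b : ℕ) : ℝ) ≤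
      (coneInstance b G).cost x := by
    rw [Nat.cast_sum]
    refine le_trans (sum_le_sum fun v hv => ?_) hcost
    have h1 : ((min #(descendants none p v) b : ℕ) : ℝ) ≤ x s(v, p v) := by
      exact_mod_cast hcap v (mem_erase.1 hv).1
    have h2 : 1 ≤ (coneInstance b G).weight s(v, p v) := by
      simp only [coneInstance]
      split_ifs
      · exact hb1.trans hnb
      · exact le_rfl
    calc _ ≤ (x s(v, p v) : ℝ) := h1
      _ ≤ _ := le_mul_of_one_le_left (Nat.cast_nonneg _) h2
  have hsum2 : (b : ℝ) * #{w | w ≠ none ∧ p w = none} ≤ (coneInstance b G).cost x := by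
    refine le_trans ?_ hcost
    have hsub : ({w | w ≠ none ∧ p w = none} : Finset (Option (Fin n))) ⊆ univ.erase none := by
      intro w hw
      simpa using (mem_filter.1 hw).2.1
    refine le_trans ?_ (sum_le_sum_of_subset_of_nonneg hsub
      fun v _ _ => mul_nonneg (hw _).le (Nat.cast_nonneg _))
    rw [mul_comm, ← nsmul_eq_mul]
    refine card_nsmul_le_sum _ _ _ fun v hv => ?_
    obtain ⟨hv1, hv2⟩ := (mem_filter.1 hv).2
    have h1 : (1 : ℝ) ≤ x s(v, p v) := by
      have := (hp v hv1).1
      rw [supportGraph, SimpleGraph.fromEdgeSet_adj] at this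
      exact_mod_cast this.1
    have h2 : (coneInstance b G).weight s(v, p v) = n / b := by
      simp [coneInstance, hv2]
    rw [h2]
    exact hnb.trans (le_mul_of_one_le_right (by positivity) h1)
  have hcard : #(univ.erase (none : Option (Fin n))) = n := by
    rw [card_erase_of_mem (mem_univ _), card_univ, Fintype.card_option, Fintype.card_fin]
    rfl
  rw [hcard] at hmain
  have h5 := mul_le_mul_of_nonneg_left hsum1 (Nat.cast_nonneg (α := ℝ) d)
  linarith

/-- Tree solutions on the cone over a `d`-regular graph cost at least of order `n log n`. -/
theorem IsTreeSolution.mul_log_le_cost {n d : ℕ} (hn : 1 ≤ n) (hd : 1 ≤ d)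
    {G : SimpleGraph (Fin n)} (hG : IsUnitExpander d G) {x : Sym2 (Option (Fin n)) → ℕ}
    (hx : (coneInstance (Nat.sqrt n) G).IsTreeSolution x) :
    (n : ℝ) * Real.log (n + 1) ≤ 2 * (d + 1) * (coneInstance (Nat.sqrt n) G).cost x := by
  have h := hx.mul_harmonic_le_cost (Nat.sqrt_pos.2 hn) (Nat.sqrt_le n) hd (by convert hG.1)
  have h1 := log_add_one_le_harmonic (Nat.sqrt n)
  have h2 : Real.log (n + 1) ≤ 2 * Real.log ((Nat.sqrt n + 1 : ℕ) : ℝ) := by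
    have h3 : n + 1 ≤ (Nat.sqrt n + 1) ^ 2 := by
      rw [pow_two]; exact Nat.sqrt_lt.1 (Nat.lt_succ_self _)
    have h4 : (n : ℝ) + 1 ≤ ((Nat.sqrt n + 1 : ℕ) : ℝ) ^ 2 := by exact_mod_cast h3
    calc Real.log (n + 1) ≤ Real.log (((Nat.sqrt n + 1 : ℕ) : ℝ) ^ 2) :=
          Real.log_le_log (by positivity) h4
      _ = _ := by rw [Real.log_pow]; norm_num
  have h6 : (n : ℝ) * Real.log (n + 1) ≤ n * (2 * harmonic (Nat.sqrt n)) :=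
    mul_le_mul_of_nonneg_left (by linarith) (Nat.cast_nonneg n)
  linarith

end FSandInstance

/-! ### The gap and its consequence for approximation ratios. -/

open FSandInstance in
theorem tree_gap_coneInstance {d : ℕ} (hd : 3 ≤ d) {n : ℕ} (hn : 1 ≤ n) {G : SimpleGraph (Fin n)}
    (hG : IsUnitExpander d G) :
    ∃ x y : Sym2 (Option (Fin n)) → ℕ,
      (coneInstance (Nat.sqrt n) G).IsOptimal x ∧
      (coneInstance (Nat.sqrt n) G).IsOptimalTree y ∧
      0 < (coneInstance (Nat.sqrt n) G).cost x ∧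
      (coneInstance (Nat.sqrt n) G).cost x ≤ (1 + d : ℝ) * n ∧
      1 / (2 * (d + 1) : ℝ) * (n * Real.log n) ≤ (coneInstance (Nat.sqrt n) G).cost y ∧
      1 / (2 * (d + 1) ^ 2 : ℝ) * Real.log (n + 1) * (coneInstance (Nat.sqrt n) G).cost x ≤
        (coneInstance (Nat.sqrt n) G).cost y := by
  have hb : 0 < Nat.sqrt n := Nat.sqrt_pos.2 hn
  have hbn : Nat.sqrt n ≤ n := Nat.sqrt_le_self n
  have hn0 : (0 : ℝ) < n := by exact_mod_cast hn
  obtain ⟨z, hz, hzc⟩ := exists_feasible_coneInstance_cost_le hb hbn hG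
  obtain ⟨x, hx, hxmin⟩ := exists_min_cost_coneInstance hb G
    (coneInstance (Nat.sqrt n) G).IsFeasible ⟨z, hz⟩
  obtain ⟨y, hy, hymin⟩ := exists_min_cost_coneInstance hb G
    (coneInstance (Nat.sqrt n) G).IsTreeSolution (exists_treeSolution_coneInstance G)
  have hxc := (hxmin z hz).trans hzc
  have hlow := hy.mul_log_le_cost hn (by omega) hG
  refine ⟨x, y, ⟨hx, hxmin⟩, ⟨hy, hymin⟩, hx.cost_pos hb hbn, hxc, ?_, ?_⟩
  · rw [one_div, inv_mul_le_iff₀ (by positivity)]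
    refine le_trans (mul_le_mul_of_nonneg_left (Real.log_le_log hn0 (by linarith)) hn0.le) hlow
  · have hlog : 0 ≤ Real.log (n + 1) := Real.log_nonneg (by linarith)
    rw [mul_assoc, one_div, inv_mul_le_iff₀ (by positivity)]
    -- The constant is the product of `d + 1` from the upper bound on the optimum and `2 * (d + 1)`
    -- from the lower bound for trees.
    calc Real.log (n + 1) * (coneInstance (Nat.sqrt n) G).cost x
        ≤ Real.log (n + 1) * ((1 + d) * n) := mul_le_mul_of_nonneg_left hxc hlog
      _ = (d + 1) * (n * Real.log (n + 1)) := by ring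
      _ ≤ (d + 1) * (2 * (d + 1) * (coneInstance (Nat.sqrt n) G).cost y) := by gcongr
      _ = _ := by ring

theorem mainTheorem4 :
    (∃ d : ℕ, 3 ≤ d ∧ ∀ n₀ : ℕ, ∃ n ≥ n₀, ∃ G : SimpleGraph (Fin n), IsUnitExpander d G) ∧
    (∀ d : ℕ, 3 ≤ d → ∃ K c γ : ℝ, 0 < K ∧ 0 < c ∧ 0 < γ ∧
      ∀ n : ℕ, 1 ≤ n → ∀ G : SimpleGraph (Fin n), IsUnitExpander d G →
        ∃ x y : Sym2 (Option (Fin n)) → ℕ,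
          (coneInstance (Nat.sqrt n) G).IsOptimal x ∧
          (coneInstance (Nat.sqrt n) G).IsOptimalTree y ∧
          0 < (coneInstance (Nat.sqrt n) G).cost x ∧
          (coneInstance (Nat.sqrt n) G).cost x ≤ K * n ∧
          c * (n * Real.log n) ≤ (coneInstance (Nat.sqrt n) G).cost y ∧
          γ * Real.log (n + 1) * (coneInstance (Nat.sqrt n) G).cost x ≤
            (coneInstance (Nat.sqrt n) G).cost y) ∧
    (∃ γ : ℝ, 0 < γ ∧ ∀ ρ : ℕ → ℝ, TreesAchieveRatio ρ →
      ∀ N₀ : ℕ, ∃ N ≥ N₀, γ * Real.log N ≤ ρ N) := by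
  refine ⟨exists_unitExpanders, fun d hd => ⟨1 + d, 1 / (2 * (d + 1)), 1 / (2 * (d + 1) ^ 2),
    by positivity, by positivity, by positivity, fun n hn G hG => tree_gap_coneInstance hd hn hG⟩,
    ?_⟩
  obtain ⟨d, hd, hexp⟩ := exists_unitExpanders
  refine ⟨1 / (2 * (d + 1) ^ 2), by positivity, fun ρ hρ N₀ => ?_⟩
  -- The shift by one ensures `1 ≤ n`. The cone has `n + 1` nodes, so the factor `Real.log (n + 1)`
  -- in the gap is the logarithm of the number of nodes.
  obtain ⟨n, hn, G, hG⟩ := hexp (N₀ + 1)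
  obtain ⟨x, y, hx, hy, hpos, -, -, hgap⟩ := tree_gap_coneInstance hd (by omega) hG
  obtain ⟨z, hz, hzρ⟩ := hρ _ (coneInstance (Nat.sqrt n) G) ⟨x, hx.1⟩
  refine ⟨n + 1, by omega, ?_⟩
  have h1 := hgap.trans ((hy.2 z hz).trans (hzρ x hx.1))
  rw [Fintype.card_option, Fintype.card_fin] at h1
  have h2 := le_of_mul_le_mul_right h1 hpos
  exact_mod_cast h2
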